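/- Let $n\ge 0$, $0<h<\infty$, $T>0$, and $X=C([-h,0],\mathbb R^n)$ with the supremum norm. Let $L:\mathbb R\to\mathcal L(X,\mathbb R^n)$ be (norm-)continuous and $T$-periodic, and let $\zeta:\mathbb R\times[0,h]\to\mathbb R^{n\times n}$ be its kernel: $\zeta$ is $T$-periodic in the first variable, $\zeta(t,\cdot)$ is of bounded variation and right-continuous on $(0,h)$, $\zeta(t,0)=0$, and $$L(t)\varphi=\int_0^h d_2\zeta(t,\theta)\,\varphi(-\theta)\qquad(t\in\mathbb R,\ \varphi\in X)$$ as a Riemann–Stieltjes integral. (A typical case is $L(t)=DF(\gamma_t)$, the linearization of a delay differential equation $\dot x(t)=F(x_t)$ with $F:X\to\mathbb R^n$ smooth along a $T$-periodic solution $\gamma$, where $x_t(\theta)=x(t+\theta)$.) Let $C_T(\mathbb R,\mathbb C^n)$ be the Banach space of continuous $T$-periodic functions $\mathbb R\to\mathbb C^n$ with the supremum norm, and $C^1_T(\mathbb R,\mathbb C^n)$ its subspace of $C^1$ functions. For $z\in\mathbb C$, the characteristic operator $\Delta(z):\mathcal D(\Delta(z))=C_T^1(\mathbb R,\mathbb C^n)\subseteq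 C_T(\mathbb R,\mathbb C^n)\to C_T(\mathbb R,\mathbb C^n)$ is $$(\Delta(z)q)(\tau)=\dot q(\tau)+zq(\tau)-\int_0^h d_2\zeta(\tau,\theta)\,e^{-z\theta}q(\tau-\theta).$$ The number $\sigma\in\mathbb C$ is a characteristic value of $\Delta$ if $\Delta(\sigma)q=0$ for some nonzero $q\in C_T^1(\mathbb R,\mathbb C^n)$. For $t\ge s$ let $U(t,s)\in\mathcal L(X)$ map $\varphi$ to $x_t$, where $x$ is the solution of $\dot x(t)=L(t)x_t$, $t\ge s$, with $x_s=\varphi$. The Floquet multipliers are the nonzero eigenvalues of the complexification of $U(s+T,s)$, and $\sigma\in\mathbb C$ is a Floquet exponent if $e^{\sigma T}$ is a Floquet multiplier. The resolvent set $\rho(A)$ of a linear operator $A:\mathcal D(A)\subseteq E\to E$ consists of the $\mu\in\mathbb C$ for which $\mu I-A$ is injective, has dense range containing $\mathcal D(A)$, and has a bounded inverse on its range; $A$ is invertible if it is a bijection from $\mathcal D(A)$ onto $E$ with bounded inverse. Then for every $z\in\mathbb C$ the operator $\Delta(z)$ is closed and $\rho(\Delta(z))\neq\emptyset$. Moreover,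 for every starting time $s\in\mathbb R$ used in the definition of Floquet exponents, $$\{\sigma\in\mathbb C:\Delta(\sigma)\text{ is not invertible}\}=\{\sigma\in\mathbb C:\sigma\text{ is a characteristic value of }\Delta\}=\{\sigma\in\mathbb C:\sigma\text{ is a Floquet exponent}\}.$$ -/

import Mathlib

noncomputable section

/-! ### Riemann-Stieltjes integrals -/

/-- `HasStieltjesIntegral h g f I` says that the Riemann-Stieltjes integral `∫_0^h dg(θ) f(θ)` of the
vector-valued function `f` against the matrix-valued function `g` exists and equals `I`: the tagged
sums converge to `I` as the mesh of the partition `0 = θ 0 ≤ … ≤ θ N = h` tends to zero, uniformly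
in the tags `ξ i ∈ [θ i, θ (i + 1)]`. -/
def HasStieltjesIntegral {𝕜 : Type*} [RCLike 𝕜] {n : ℕ} (h : ℝ)
    (g : ℝ → Matrix (Fin n) (Fin n) ℝ) (f : ℝ → Fin n → 𝕜) (I : Fin n → 𝕜) : Prop :=
  ∀ ε : ℝ, 0 < ε → ∃ δ : ℝ, 0 < δ ∧ ∀ (N : ℕ) (θ ξ : ℕ → ℝ), θ 0 = 0 → θ N = h →
    (∀ i < N, θ i ≤ ξ i ∧ ξ i ≤ θ (i + 1) ∧ θ (i + 1) - θ i < δ) →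
    ‖(∑ i ∈ Finset.range N,
        ((g (θ (i + 1)) - g (θ i)).map (algebraMap ℝ 𝕜)).mulVec (f (ξ i))) - I‖ < ε

open Classical in
/-- The Riemann-Stieltjes integral `∫_0^h dg(θ) f(θ)`, with value `0` where it does not exist. -/
def stieltjesIntegral {𝕜 : Type*} [RCLike 𝕜] {n : ℕ} (h : ℝ)
    (g : ℝ → Matrix (Fin n) (Fin n) ℝ) (f : ℝ → Fin n → 𝕜) : Fin n → 𝕜 :=
  if H : ∃ I, HasStieltjesIntegral h g f I then H.choose else 0

namespace HasStieltjesIntegral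

variable {𝕜 : Type*} [RCLike 𝕜] {n : ℕ} {h : ℝ} {g : ℝ → Matrix (Fin n) (Fin n) ℝ}
  {f f' : ℝ → Fin n → 𝕜} {I I' : Fin n → 𝕜}

lemma partition_mem {N : ℕ} {θ ξ : ℕ → ℝ} (h0 : θ 0 = 0) (hN : θ N = h)
    (hp : ∀ i < N, θ i ≤ ξ i ∧ ξ i ≤ θ (i + 1)) {i : ℕ} (hi : i < N) : ξ i ∈ Set.Icc 0 h := by
  have h1 : ∀ j, j ≤ N → 0 ≤ θ j := by
    intro j
    induction j with
    | zero => intro _; exact h0.ge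
    | succ j ih =>
      intro hj
      have := hp j (by omega)
      linarith [ih (by omega)]
  have h2 : ∀ j, j ≤ N → θ (N - j) ≤ h := by
    intro j
    induction j with
    | zero => intro _; simpa using hN.le
    | succ j ih =>
      intro hj
      have := hp (N - (j + 1)) (by omega)
      rw [show N - (j + 1) + 1 = N - j by omega] at this
      linarith [ih (by omega)]
  refine ⟨(h1 i hi.le).trans (hp i hi).1, (hp i hi).2.trans ?_⟩
  have := h2 (N - (i + 1)) (by omega)
  rwa [show N - (N - (i + 1)) = i + 1 by omega] at this

lemma congr (H : HasStieltjesIntegral h g f I) (hf : ∀ θ ∈ Set.Icc 0 h, f θ = f' θ) :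
    HasStieltjesIntegral h g f' I := by
  intro ε hε
  obtain ⟨δ, hδ, H⟩ := H ε hε
  refine ⟨δ, hδ, fun N θ ξ h0 hN hp => ?_⟩
  have := H N θ ξ h0 hN hp
  rwa [Finset.sum_congr rfl (fun i hi => by
    rw [hf (ξ i) (partition_mem h0 hN (fun j hj => ⟨(hp j hj).1, (hp j hj).2.1⟩)
      (Finset.mem_range.1 hi))])] at this

lemma add (H : HasStieltjesIntegral h g f I) (H' : HasStieltjesIntegral h g f' I') :
    HasStieltjesIntegral h g (fun θ => f θ + f' θ) (I + I') := by
  intro ε hε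
  obtain ⟨δ, hδ, H⟩ := H (ε / 2) (by linarith)
  obtain ⟨δ', hδ', H'⟩ := H' (ε / 2) (by linarith)
  refine ⟨min δ δ', lt_min hδ hδ', fun N θ ξ h0 hN hp => ?_⟩
  have h1 := H N θ ξ h0 hN (fun i hi => ⟨(hp i hi).1, (hp i hi).2.1,
    (hp i hi).2.2.trans_le (min_le_left _ _)⟩)
  have h2 := H' N θ ξ h0 hN (fun i hi => ⟨(hp i hi).1, (hp i hi).2.1,
    (hp i hi).2.2.trans_le (min_le_right _ _)⟩)
  simp only [Matrix.mulVec_add, Finset.sum_add_distrib]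
  rw [add_sub_add_comm]
  exact (norm_add_le _ _).trans_lt (by linarith)

lemma smul (c : 𝕜) (H : HasStieltjesIntegral h g f I) :
    HasStieltjesIntegral h g (fun θ => c • f θ) (c • I) := by
  intro ε hε
  obtain ⟨δ, hδ, H⟩ := H (ε / (‖c‖ + 1)) (by positivity)
  refine ⟨δ, hδ, fun N θ ξ h0 hN hp => ?_⟩
  have h1 := H N θ ξ h0 hN hp
  simp only [Matrix.mulVec_smul, ← Finset.smul_sum]
  rw [← smul_sub, norm_smul]
  rw [lt_div_iff₀ (by positivity)] at h1
  nlinarith [norm_nonneg c, norm_nonneg ((∑ i ∈ Finset.range N,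
        ((g (θ (i + 1)) - g (θ i)).map (algebraMap ℝ 𝕜)).mulVec (f (ξ i))) - I)]

lemma unique (hh : 0 < h) (H : HasStieltjesIntegral h g f I) (H' : HasStieltjesIntegral h g f I') :
    I = I' := by
  by_contra hne
  have hpos : 0 < ‖I - I'‖ := norm_pos_iff.2 (sub_ne_zero.2 hne)
  obtain ⟨δ, hδ, H⟩ := H (‖I - I'‖ / 2) (by linarith)
  obtain ⟨δ', hδ', H'⟩ := H' (‖I - I'‖ / 2) (by linarith)
  obtain ⟨N, hN⟩ := exists_nat_gt (h / min δ δ')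
  have hm : 0 < min δ δ' := lt_min hδ hδ'
  have hN0 : (0 : ℝ) < N := lt_of_le_of_lt (by positivity) hN
  have hmesh : h / N < min δ δ' := by
    rw [div_lt_iff₀ hm] at hN
    rw [div_lt_iff₀ hN0]
    linarith
  have key : ∀ i : ℕ, ((i : ℝ) * (h / N)) ≤ (i : ℝ) * (h / N) ∧
      (i : ℝ) * (h / N) ≤ ((i + 1 : ℕ) : ℝ) * (h / N) ∧
      ((i + 1 : ℕ) : ℝ) * (h / N) - (i : ℝ) * (h / N) = h / N := by
    intro i
    have : 0 < h / N := by positivity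
    refine ⟨le_rfl, ?_, ?_⟩ <;> push_cast <;> nlinarith
  have h1 := H N (fun i => (i : ℝ) * (h / N)) (fun i => (i : ℝ) * (h / N)) (by simp)
    (by field_simp) (fun i _ => ⟨(key i).1, (key i).2.1,
      (key i).2.2.trans_lt (hmesh.trans_le (min_le_left _ _))⟩)
  have h2 := H' N (fun i => (i : ℝ) * (h / N)) (fun i => (i : ℝ) * (h / N)) (by simp)
    (by field_simp) (fun i _ => ⟨(key i).1, (key i).2.1,
      (key i).2.2.trans_lt (hmesh.trans_le (min_le_right _ _))⟩)
  have h3 : ‖I - I'‖ < ‖I - I'‖ / 2 + ‖I - I'‖ / 2 := by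
    refine lt_of_le_of_lt ?_ (add_lt_add h2 h1)
    rw [← sub_sub_sub_cancel_left]
    exact norm_sub_le _ _
  linarith

lemma eq_integral (hh : 0 < h) (H : HasStieltjesIntegral h g f I) :
    stieltjesIntegral h g f = I := by
  have hex : ∃ I, HasStieltjesIntegral h g f I := ⟨I, H⟩
  rw [stieltjesIntegral, dif_pos hex]
  exact unique hh hex.choose_spec H

/-- Real integrals are complex integrals of real functions. -/
lemma ofReal {f : ℝ → Fin n → ℝ} {I : Fin n → ℝ} (H : HasStieltjesIntegral h g f I) :
    HasStieltjesIntegral h g (fun θ i => (f θ i : ℂ)) (fun i => (I i : ℂ)) := by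
  intro ε hε
  obtain ⟨δ, hδ, H⟩ := H ε hε
  refine ⟨δ, hδ, fun N θ ξ h0 hN hp => ?_⟩
  have h1 := H N θ ξ h0 hN hp
  refine lt_of_eq_of_lt ?_ h1
  have : (∑ i ∈ Finset.range N, ((g (θ (i + 1)) - g (θ i)).map (algebraMap ℝ ℂ)).mulVec
      (fun j => (f (ξ i) j : ℂ))) - (fun i => (I i : ℂ)) =
      fun k => (((∑ i ∈ Finset.range N, ((g (θ (i + 1)) - g (θ i)).map (algebraMap ℝ ℝ)).mulVec
        (f (ξ i))) - I) k : ℂ) := by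
    funext k
    simp [Matrix.mulVec, dotProduct, Finset.sum_apply]
  rw [this]
  simp only [Pi.norm_def]
  congr 2
  funext k
  exact NNReal.eq (by rw [coe_nnnorm, coe_nnnorm, Complex.norm_real])

end HasStieltjesIntegral

/-! ### Spaces of functions and complexification -/

/-- The segment `x_t ∈ C([-h, 0], E)`, `x_t(θ) = x(t + θ)`, of a continuous function `x`. -/
def history {E : Type*} [TopologicalSpace E] (h : ℝ) (x : C(ℝ, E)) (t : ℝ) :
    C(Set.Icc (-h) (0 : ℝ), E) :=
  ⟨fun θ => x (t + θ), by fun_prop⟩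

/-- Pointwise real part `C([-h, 0], ℂⁿ) → C([-h, 0], ℝⁿ)`. -/
def rePart {n : ℕ} {h : ℝ} (φ : C(Set.Icc (-h) (0 : ℝ), Fin n → ℂ)) :
    C(Set.Icc (-h) (0 : ℝ), Fin n → ℝ) :=
  ⟨fun θ i => (φ θ i).re, by fun_prop⟩

/-- Pointwise imaginary part `C([-h, 0], ℂⁿ) → C([-h, 0], ℝⁿ)`. -/
def imPart {n : ℕ} {h : ℝ} (φ : C(Set.Icc (-h) (0 : ℝ), Fin n → ℂ)) :
    C(Set.Icc (-h) (0 : ℝ), Fin n → ℝ) :=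
  ⟨fun θ i => (φ θ i).im, by fun_prop⟩

/-- The inclusion `C([-h, 0], ℝⁿ) → C([-h, 0], ℂⁿ)`. -/
def ofRealPart {n : ℕ} {h : ℝ} (φ : C(Set.Icc (-h) (0 : ℝ), Fin n → ℝ)) :
    C(Set.Icc (-h) (0 : ℝ), Fin n → ℂ) :=
  ⟨fun θ i => (φ θ i : ℂ), by fun_prop⟩

/-- The complexification `φ + i ψ ↦ A φ + i A ψ` of a real operator `A` on `C([-h, 0], ℝⁿ)`, acting
on `C([-h, 0], ℂⁿ)`. -/
def complexify {n : ℕ} {h : ℝ}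
    (A : C(Set.Icc (-h) (0 : ℝ), Fin n → ℝ) →L[ℝ] C(Set.Icc (-h) (0 : ℝ), Fin n → ℝ)) :
    C(Set.Icc (-h) (0 : ℝ), Fin n → ℂ) →ₗ[ℂ] C(Set.Icc (-h) (0 : ℝ), Fin n → ℂ) where
  toFun φ := ofRealPart (A (rePart φ)) + Complex.I • ofRealPart (A (imPart φ))
  map_add' φ ψ := by
    have h1 : rePart (φ + ψ) = rePart φ + rePart ψ := by ext; simp [rePart]
    have h2 : imPart (φ + ψ) = imPart φ + imPart ψ := by ext; simp [imPart]
    rw [h1, h2, map_add, map_add]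
    ext θ i
    simp [ofRealPart]
    ring
  map_smul' c φ := by
    have h1 : rePart (c • φ) = c.re • rePart φ - c.im • imPart φ := by
      ext; simp [rePart, imPart]
    have h2 : imPart (c • φ) = c.re • imPart φ + c.im • rePart φ := by
      ext; simp [rePart, imPart]
    rw [h1, h2, map_add, map_sub, map_smul, map_smul, map_smul, map_smul]
    ext θ i
    apply Complex.ext <;> simp [ofRealPart] <;> ring

/-- `C_T(ℝ, ℂⁿ)`: the Banach space of continuous `T`-periodic functions with the supremum norm. -/
def CT (T : ℝ) (n : ℕ) : Submodule ℂ (BoundedContinuousFunction ℝ (Fin n → ℂ)) where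
  carrier := {q | Function.Periodic q T}
  add_mem' := fun {p q} hp hq t => by simp [hp t, hq t]
  zero_mem' := fun t => by simp
  smul_mem' := fun c q hq t => by simp [hq t]

/-- A continuous `T`-periodic function as an element of `C_T(ℝ, ℂⁿ)`. -/
def CT.mk {T : ℝ} {n : ℕ} (hT : 0 < T) (f : ℝ → Fin n → ℂ) (hf : Continuous f)
    (hp : Function.Periodic f T) : CT T n :=
  ⟨BoundedContinuousFunction.mkOfBound ⟨f, hf⟩
      (Metric.isBounded_iff.1 (hp.isBounded_of_continuous hT.ne' hf)).choose
      (fun x y => (Metric.isBounded_iff.1 (hp.isBounded_of_continuous hT.ne' hf)).choose_spec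
        (Set.mem_range_self x) (Set.mem_range_self y)), hp⟩

/-- `C_T^1(ℝ, ℂⁿ)`: the continuously differentiable functions in `C_T(ℝ, ℂⁿ)`. -/
def CT1 (T : ℝ) (n : ℕ) : Submodule ℂ (CT T n) where
  carrier := {q | ContDiff ℝ 1 (q.1 : ℝ → Fin n → ℂ)}
  add_mem' := fun {p q} (hp : ContDiff ℝ 1 (p.1 : ℝ → Fin n → ℂ))
    (hq : ContDiff ℝ 1 (q.1 : ℝ → Fin n → ℂ)) => hp.add hq
  zero_mem' := (contDiff_const : ContDiff ℝ 1 (fun _ : ℝ => (0 : Fin n → ℂ)))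
  smul_mem' := fun c q (hq : ContDiff ℝ 1 (q.1 : ℝ → Fin n → ℂ)) => hq.const_smul c

lemma CT1.contDiff {T : ℝ} {n : ℕ} (q : CT1 T n) : ContDiff ℝ 1 (q.1.1 : ℝ → Fin n → ℂ) := q.2

/-! ### Notions for unbounded operators -/

/-- The resolvent set of a linear operator `A : D(A) ⊆ E → E`: the set of `z` for which `z I - A` is
injective, has dense range containing `D(A)`, and has a bounded inverse on its range. -/
def opResolventSet {E : Type*} [NormedAddCommGroup E] [NormedSpace ℂ E] (A : E →ₗ.[ℂ] E) : Set ℂ :=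
  {z | Function.Injective (fun x : A.domain => z • (x : E) - A x) ∧
    DenseRange (fun x : A.domain => z • (x : E) - A x) ∧
    (A.domain : Set E) ⊆ Set.range (fun x : A.domain => z • (x : E) - A x) ∧
    ∃ C : ℝ, ∀ x : A.domain, ‖(x : E)‖ ≤ C * ‖z • (x : E) - A x‖}

/-- A linear operator `A : D(A) ⊆ E → E` is invertible if it is a bijection from `D(A)` onto `E`
with bounded inverse. -/
def OpInvertible {E : Type*} [NormedAddCommGroup E] [NormedSpace ℂ E] (A : E →ₗ.[ℂ] E) : Prop :=
  ∃ R : E →L[ℂ] E, (∀ x : A.domain, R (A x) = x) ∧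
    ∀ y : E, ∃ hy : R y ∈ A.domain, A ⟨R y, hy⟩ = y

/-! ### Periodic linear delay differential equations -/

/-- A `T`-periodic linear delay differential equation `y'(t) = L(t) y_t` in `ℝⁿ` with history space
`X = C([-h, 0], ℝⁿ)`, together with the kernel `ζ` that represents it. -/
structure PeriodicLinearDDE (n : ℕ) (h T : ℝ) where
  h_pos : 0 < h
  T_pos : 0 < T
  /-- the bounded linear operators `L(t) : X → ℝⁿ` -/
  L : ℝ → C(Set.Icc (-h) (0 : ℝ), Fin n → ℝ) →L[ℝ] (Fin n → ℝ)
  continuous_L : Continuous L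
  periodic_L : Function.Periodic L T
  /-- the kernel `ζ(t, θ)`, of which only the values for `θ ∈ [0, h]` matter -/
  ζ : ℝ → ℝ → Matrix (Fin n) (Fin n) ℝ
  bounded_variation : ∀ t i j, BoundedVariationOn (fun θ => ζ t θ i j) (Set.Icc 0 h)
  right_continuous : ∀ t, ∀ θ ∈ Set.Ioo 0 h, ContinuousWithinAt (ζ t) (Set.Ici θ) θ
  periodic_ζ : Function.Periodic ζ T
  ζ_zero : ∀ t, ζ t 0 = 0
  /-- `L(t) φ = ∫_0^h d₂ζ(t, θ) φ(-θ)` for all `φ ∈ X` -/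
  representation : ∀ t (φ : C(Set.Icc (-h) (0 : ℝ), Fin n → ℝ)), HasStieltjesIntegral h (ζ t)
    (fun θ => Set.IccExtend (neg_nonpos.2 h_pos.le) φ (-θ)) (L t φ)

namespace PeriodicLinearDDE

variable {n : ℕ} {h T : ℝ} (D : PeriodicLinearDDE n h T)

/-! #### The characteristic operator -/

lemma hasStieltjesIntegral_history (t : ℝ) (x : C(ℝ, Fin n → ℝ)) :
    HasStieltjesIntegral h (D.ζ t) (fun θ => x (t - θ)) (D.L t (history h x t)) := by
  refine (D.representation t (history h x t)).congr (fun θ hθ => ?_)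
  rw [Set.IccExtend_of_mem (neg_nonpos.2 D.h_pos.le) _ (x := -θ)
    ⟨by linarith [hθ.2], by linarith [hθ.1]⟩]
  simp [history, sub_eq_add_neg]

lemma continuous_history {E : Type*} [TopologicalSpace E] (h : ℝ) (x : C(ℝ, E)) :
    Continuous (history h x) :=
  (ContinuousMap.curry (⟨fun p : ℝ × Set.Icc (-h) (0 : ℝ) => x (p.1 + p.2), by fun_prop⟩ :
    C(ℝ × Set.Icc (-h) (0 : ℝ), E))).continuous

lemma hasStieltjesIntegral_exp (z : ℂ) {q : ℝ → Fin n → ℂ} (hq : Continuous q) (τ : ℝ) :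
    HasStieltjesIntegral h (D.ζ τ) (fun θ => Complex.exp (-z * θ) • q (τ - θ))
      (Complex.exp (-z * τ) •
        ((fun i => (D.L τ (history h ⟨fun r i => (Complex.exp (z * r) * q r i).re,
          by fun_prop⟩ τ) i : ℂ)) +
        Complex.I • fun i => (D.L τ (history h ⟨fun r i => (Complex.exp (z * r) * q r i).im,
          by fun_prop⟩ τ) i : ℂ))) := by
  refine (((D.hasStieltjesIntegral_history τ _).ofReal.add
    ((D.hasStieltjesIntegral_history τ _).ofReal.smul Complex.I)).smul
      (Complex.exp (-z * τ))).congr (fun θ _ => ?_)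
  funext i
  have h1 : Complex.exp (-z * θ) = Complex.exp (-z * τ) * Complex.exp (z * (τ - θ : ℝ)) := by
    rw [← Complex.exp_add]
    congr 1
    push_cast
    ring
  have h2 := Complex.re_add_im (Complex.exp (z * (τ - θ : ℝ)) * q (τ - θ) i)
  simp only [ContinuousMap.coe_mk, Pi.smul_apply, Pi.add_apply, smul_eq_mul]
  rw [h1, mul_assoc, mul_comm Complex.I, h2]

/-- The function `τ ↦ q'(τ) + z q(τ) - ∫_0^h d₂ζ(τ, θ) e^{-zθ} q(τ - θ)`. -/
def charFun (z : ℂ) (q : ℝ → Fin n → ℂ) (τ : ℝ) : Fin n → ℂ :=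
  deriv q τ + z • q τ -
    stieltjesIntegral h (D.ζ τ) (fun θ => Complex.exp (-z * θ) • q (τ - θ))

lemma continuous_charFun (z : ℂ) {q : ℝ → Fin n → ℂ} (hq : ContDiff ℝ 1 q) :
    Continuous (D.charFun z q) := by
  have hL := D.continuous_L
  have h1 : Continuous (fun τ => stieltjesIntegral h (D.ζ τ)
      (fun θ => Complex.exp (-z * θ) • q (τ - θ))) := by
    simp_rw [fun τ => (D.hasStieltjesIntegral_exp z hq.continuous τ).eq_integral D.h_pos]
    have h2 : ∀ x : C(ℝ, Fin n → ℝ), Continuous fun τ => D.L τ (history h x τ) :=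
      fun x => hL.clm_apply (continuous_history h x)
    have h3 : ∀ x : C(ℝ, Fin n → ℝ), Continuous fun τ => (fun i => (D.L τ (history h x τ) i : ℂ)) :=
      fun x => continuous_pi fun i =>
        Complex.continuous_ofReal.comp ((continuous_apply i).comp (h2 x))
    have h4 : Continuous fun τ : ℝ => Complex.exp (-z * τ) := by fun_prop
    exact h4.smul ((h3 _).add ((h3 _).const_smul Complex.I :
      Continuous fun τ => Complex.I • fun i => (D.L τ (history h _ τ) i : ℂ)))
  exact ((hq.continuous_deriv le_rfl).add (hq.continuous.const_smul z)).sub h1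

lemma periodic_charFun (z : ℂ) {q : ℝ → Fin n → ℂ} (hq : Function.Periodic q T) :
    Function.Periodic (D.charFun z q) T := by
  intro τ
  have h1 : deriv q (τ + T) = deriv q τ := by
    rw [← deriv_comp_add_const]
    congr 1
    exact funext hq
  have h2 : ∀ θ : ℝ, q (τ + T - θ) = q (τ - θ) := fun θ => by
    rw [← hq (τ - θ)]
    congr 1
    ring
  simp only [charFun, h1, hq τ, D.periodic_ζ τ, h2]

/-- The characteristic operator `Δ(z) : D(Δ(z)) = C_T^1(ℝ, ℂⁿ) ⊆ C_T(ℝ, ℂⁿ) → C_T(ℝ, ℂⁿ)`,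
`(Δ(z) q)(τ) = q'(τ) + z q(τ) - ∫_0^h d₂ζ(τ, θ) e^{-zθ} q(τ - θ)`. -/
def charOp (z : ℂ) : CT T n →ₗ.[ℂ] CT T n where
  domain := CT1 T n
  toFun :=
    { toFun := fun q => CT.mk D.T_pos (D.charFun z q.1.1) (D.continuous_charFun z (CT1.contDiff q))
        (D.periodic_charFun z q.1.2)
      map_add' := fun p q => by
        refine Subtype.ext (BoundedContinuousFunction.ext fun τ => ?_)
        have hp := (CT1.contDiff p).differentiable one_ne_zero τ
        have hq := (CT1.contDiff q).differentiable one_ne_zero τ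
        have hpi := D.hasStieltjesIntegral_exp z (CT1.contDiff p).continuous τ
        have hqi := D.hasStieltjesIntegral_exp z (CT1.contDiff q).continuous τ
        have hi := (hpi.add hqi).eq_integral D.h_pos
        rw [← hpi.eq_integral D.h_pos, ← hqi.eq_integral D.h_pos] at hi
        have hd := deriv_add hp hq
        change D.charFun z (⇑p.1.1 + ⇑q.1.1) τ =
          D.charFun z p.1.1 τ + D.charFun z q.1.1 τ
        simp only [charFun, Pi.add_apply, smul_add, hd, hi]
        abel
      map_smul' := fun c q => by
        refine Subtype.ext (BoundedContinuousFunction.ext fun τ => ?_)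
        have hq := (CT1.contDiff q).differentiable one_ne_zero τ
        have hqi := D.hasStieltjesIntegral_exp z (CT1.contDiff q).continuous τ
        have hi := (hqi.smul c).eq_integral D.h_pos
        rw [← hqi.eq_integral D.h_pos] at hi
        have hd := deriv_const_smul c hq
        change D.charFun z (c • ⇑q.1.1) τ = c • D.charFun z q.1.1 τ
        simp only [charFun, Pi.smul_apply, smul_comm _ c, hd, hi]
        rw [smul_sub, smul_add] }

/-- `σ` is a characteristic value of `Δ` if `Δ(σ) q = 0` for some nonzero `q ∈ C_T^1(ℝ, ℂⁿ)`. -/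
def IsCharacteristicValue (σ : ℂ) : Prop :=
  ∃ q : (D.charOp σ).domain, q ≠ 0 ∧ D.charOp σ q = 0

/-! #### The evolutionary system and Floquet exponents -/

/-- `x` solves `x'(t) = L(t) x_t` for `t ≥ s` with initial condition `x_s = φ` (the derivative is
one-sided at `t = s`; the values of `x` before `s - h` play no role). -/
structure IsSolution (s : ℝ) (φ : C(Set.Icc (-h) (0 : ℝ), Fin n → ℝ)) (x : C(ℝ, Fin n → ℝ)) :
    Prop where
  initial : history h x s = φ
  deriv : ∀ t, s ≤ t → HasDerivWithinAt x (D.L t (history h x t)) (Set.Ici s) t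


lemma exists_bound : ∃ M : ℝ, 0 < M ∧ ∀ t, ‖D.L t‖ ≤ M := by
  obtain ⟨M, hM⟩ :=
    (D.periodic_L.isBounded_of_continuous D.T_pos.ne' D.continuous_L).exists_norm_le
  exact ⟨max M 1, by positivity, fun t =>
    (hM _ (Set.mem_range_self t)).trans (le_max_left _ _)⟩

lemma continuous_L_history (x : C(ℝ, Fin n → ℝ)) :
    Continuous fun t => D.L t (history h x t) :=
  D.continuous_L.clm_apply (continuous_history h x)

variable {D} in
lemma IsSolution.eq_integral {s : ℝ} {φ : C(Set.Icc (-h) (0 : ℝ), Fin n → ℝ)}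
    {x : C(ℝ, Fin n → ℝ)} (hx : D.IsSolution s φ x) {t : ℝ} (ht : s ≤ t) :
    x t = x s + ∫ r in s..t, D.L r (history h x r) := by
  rw [intervalIntegral.integral_eq_sub_of_hasDeriv_right (f := x) x.continuous.continuousOn
    (fun r hr => ?_) ((D.continuous_L_history x).intervalIntegrable _ _)]
  · abel
  · rw [min_eq_left ht, max_eq_right ht] at hr
    exact (hx.deriv r hr.1.le).mono (fun y hy => hr.1.le.trans (le_of_lt hy))

lemma norm_integral_le {s M K a : ℝ} (hM : 0 ≤ M) (hK : 0 ≤ K) (ha : 0 < a) (hLM : ∀ t, ‖D.L t‖ ≤ M)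
    (x : C(ℝ, Fin n → ℝ)) {t : ℝ} (ht : s ≤ t)
    (hx : ∀ r ∈ Set.Icc (s - h) t, ‖x r‖ ≤ K * Real.exp (a * max 0 (r - s))) :
    ‖∫ r in s..t, D.L r (history h x r)‖ ≤ M / a * K * Real.exp (a * (t - s)) := by
  have h1 : ∀ r ∈ Set.Ioc s t, ‖D.L r (history h x r)‖ ≤ M * K * Real.exp (a * (r - s)) := by
    intro r hr
    refine ((D.L r).le_opNorm _).trans ?_
    rw [mul_assoc]
    refine mul_le_mul (hLM r) ?_ (norm_nonneg _) hM
    refine (ContinuousMap.norm_le _ (by positivity)).2 (fun θ => ?_)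
    refine (hx (r + θ) ⟨by linarith [hr.1, θ.2.1], by linarith [hr.2, θ.2.2]⟩).trans ?_
    refine mul_le_mul_of_nonneg_left (Real.exp_le_exp.2 ?_) hK
    refine mul_le_mul_of_nonneg_left ?_ ha.le
    exact max_le (by linarith [hr.1]) (by linarith [θ.2.2])
  have h2 : ∀ r : ℝ, HasDerivAt (fun r => M / a * K * Real.exp (a * (r - s)))
      (M * K * Real.exp (a * (r - s))) r := by
    intro r
    have := ((((hasDerivAt_id r).sub_const s).const_mul a).exp).const_mul (M / a * K)
    refine this.congr_deriv ?_
    simp only [id_eq]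
    field_simp
  have h3 : Continuous fun r => M * K * Real.exp (a * (r - s)) := by fun_prop
  refine (intervalIntegral.norm_integral_le_of_norm_le ht
    (MeasureTheory.ae_of_all _ h1) (h3.intervalIntegrable _ _)).trans ?_
  rw [intervalIntegral.integral_eq_sub_of_hasDerivAt (fun r _ => h2 r) (h3.intervalIntegrable _ _)]
  have : 0 ≤ M / a * K * Real.exp (a * (s - s)) := by positivity
  linarith

/-- A priori bound for solutions. -/
lemma exists_growth_bound : ∃ a : ℝ, ∀ (s : ℝ) (φ : C(Set.Icc (-h) (0 : ℝ), Fin n → ℝ))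
    (x : C(ℝ, Fin n → ℝ)), D.IsSolution s φ x → ∀ t, s ≤ t →
      ‖x t‖ ≤ 2 * ‖φ‖ * Real.exp (a * (t - s)) := by
  obtain ⟨M, hM, hLM⟩ := D.exists_bound
  refine ⟨2 * M, fun s φ x hx t ht => ?_⟩
  have hφ : ∀ r ∈ Set.Icc (s - h) s, ‖x r‖ ≤ ‖φ‖ := by
    intro r hr
    rw [← hx.initial]
    have := (history h x s).norm_coe_le_norm ⟨r - s, by linarith [hr.1], by linarith [hr.2]⟩
    simpa [history] using this
  let f : ℝ → ℝ := fun r => ‖x r‖ * Real.exp (-(2 * M * max 0 (r - s)))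
  have hf : Continuous f := by fun_prop
  have hh := D.h_pos
  obtain ⟨c, hc, hmax⟩ := (isCompact_Icc (a := s - h) (b := t)).exists_isMaxOn
    ⟨s, by linarith, ht⟩ hf.continuousOn
  have hfx : ∀ r, ‖x r‖ = f r * Real.exp (2 * M * max 0 (r - s)) := by
    intro r
    simp only [f]
    rw [mul_assoc, ← Real.exp_add, neg_add_cancel, Real.exp_zero, mul_one]
  have hf0 : 0 ≤ f c := by positivity
  have hfc : f c ≤ 2 * ‖φ‖ := by
    rcases le_total c s with hcs | hcs
    · have h1 := hφ c ⟨hc.1, hcs⟩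
      rw [hfx c, max_eq_left (by linarith), mul_zero, Real.exp_zero, mul_one] at h1
      linarith [norm_nonneg φ]
    · have h1 := D.norm_integral_le (s := s) hM.le hf0 (by positivity : 0 < 2 * M) hLM x hcs
        (fun r hr => by
          rw [hfx r]
          exact mul_le_mul_of_nonneg_right (hmax ⟨hr.1, hr.2.trans hc.2⟩) (Real.exp_pos _).le)
      have h2 : ‖x c‖ ≤ ‖φ‖ + M / (2 * M) * f c * Real.exp (2 * M * (c - s)) := by
        rw [hx.eq_integral hcs]
        exact (norm_add_le _ _).trans (add_le_add (hφ s ⟨by linarith, le_rfl⟩) h1)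
      rw [hfx c, max_eq_right (by linarith)] at h2
      have h3 : M / (2 * M) = 1 / 2 := by field_simp
      rw [h3] at h2
      have h4 : 1 ≤ Real.exp (2 * M * (c - s)) := Real.one_le_exp (by nlinarith)
      have h5 : f c * Real.exp (2 * M * (c - s)) ≤ (2 * ‖φ‖) * Real.exp (2 * M * (c - s)) := by
        nlinarith [norm_nonneg φ]
      exact le_of_mul_le_mul_right h5 (by positivity)
  have h6 : f t ≤ f c := hmax ⟨by linarith, le_rfl⟩
  rw [hfx t, max_eq_right (by linarith)]
  exact mul_le_mul_of_nonneg_right (h6.trans hfc) (Real.exp_pos _).le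

variable {D} in
lemma IsSolution.add {s : ℝ} {φ ψ : C(Set.Icc (-h) (0 : ℝ), Fin n → ℝ)}
    {x y : C(ℝ, Fin n → ℝ)} (hx : D.IsSolution s φ x) (hy : D.IsSolution s ψ y) :
    D.IsSolution s (φ + ψ) (x + y) where
  initial := by rw [← hx.initial, ← hy.initial]; rfl
  deriv t ht := by
    have h1 : history h (x + y) t = history h x t + history h y t := rfl
    rw [h1, map_add]
    exact (hx.deriv t ht).add (hy.deriv t ht)

variable {D} in
lemma IsSolution.smul {s : ℝ} {φ : C(Set.Icc (-h) (0 : ℝ), Fin n → ℝ)}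
    {x : C(ℝ, Fin n → ℝ)} (c : ℝ) (hx : D.IsSolution s φ x) :
    D.IsSolution s (c • φ) (c • x) where
  initial := by rw [← hx.initial]; rfl
  deriv t ht := by
    have h1 : history h (c • x) t = c • history h x t := rfl
    rw [h1, map_smul]
    exact (hx.deriv t ht).const_smul c

variable {D} in
/-- Solutions of the initial value problem are unique. -/
lemma IsSolution.unique {s : ℝ} {φ : C(Set.Icc (-h) (0 : ℝ), Fin n → ℝ)}
    {x y : C(ℝ, Fin n → ℝ)} (hx : D.IsSolution s φ x) (hy : D.IsSolution s φ y) {t : ℝ}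
    (ht : s - h ≤ t) : x t = y t := by
  rcases le_total s t with hst | hst
  · obtain ⟨a, ha⟩ := D.exists_growth_bound
    have h1 := ha s _ _ (hx.add (hy.smul (-1))) t hst
    have h0 : φ + (-1 : ℝ) • φ = 0 := by rw [neg_one_smul, add_neg_cancel]
    rw [h0, norm_zero, mul_zero, zero_mul] at h1
    have h2 := norm_le_zero_iff.1 h1
    rwa [neg_one_smul, ContinuousMap.add_apply, ContinuousMap.neg_apply,
      add_neg_eq_zero] at h2
  · have h1 := congrArg (fun ψ : C(Set.Icc (-h) (0 : ℝ), Fin n → ℝ) =>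
      ψ ⟨t - s, by linarith, by linarith⟩) (hx.initial.trans hy.initial.symm)
    simpa [history] using h1

/-- Solutions of the initial value problem exist. -/
lemma exists_isSolution (s : ℝ) (φ : C(Set.Icc (-h) (0 : ℝ), Fin n → ℝ)) :
    ∃ x, D.IsSolution s φ x := by
  obtain ⟨M, hM, hLM⟩ := D.exists_bound
  have hh := D.h_pos
  have ha : 0 < 2 * M := by positivity
  let w : C(ℝ, ℝ) := ⟨fun t => Real.exp (2 * M * max 0 (t - s)), by fun_prop⟩
  have hw : ∀ t, 0 < w t := fun t => Real.exp_pos _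
  have hw1 : ∀ t, 1 ≤ w t := fun t => Real.one_le_exp (by positivity)
  let φ' : C(ℝ, Fin n → ℝ) := ⟨fun t => Set.IccExtend (neg_nonpos.2 hh.le) φ (t - s), by fun_prop⟩
  have hφ' : ∀ t, ‖φ' t‖ ≤ ‖φ‖ := fun t => φ.norm_coe_le_norm _
  let J : C(ℝ, Fin n → ℝ) → ℝ → (Fin n → ℝ) := fun x t =>
    ∫ r in s..max s t, D.L r (history h x r)
  have hJc : ∀ x, Continuous (J x) := fun x =>
    (intervalIntegral.continuous_primitive
      (fun a b => (D.continuous_L_history x).intervalIntegrable a b) s).comp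
      (continuous_const.max continuous_id)
  have hJ : ∀ (K : ℝ) (x : C(ℝ, Fin n → ℝ)), 0 ≤ K → (∀ r, ‖x r‖ ≤ K * w r) →
      ∀ t, ‖J x t‖ ≤ 1 / 2 * K * w t := by
    intro K x hK hx t
    have h1 := D.norm_integral_le (s := s) hM.le hK ha hLM x (le_max_left s t) (fun r _ => hx r)
    have h2 : M / (2 * M) = 1 / 2 := by field_simp
    rw [h2] at h1
    have h3 : max 0 (t - s) = max s t - s := by
      rw [← max_sub_sub_right, sub_self]
    simpa only [w, ContinuousMap.coe_mk, h3] using h1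
  let wy : BoundedContinuousFunction ℝ (Fin n → ℝ) → C(ℝ, Fin n → ℝ) := fun y =>
    ⟨fun t => w t • y t, by fun_prop⟩
  have hwy : ∀ y r, ‖wy y r‖ ≤ ‖y‖ * w r := by
    intro y r
    simp only [wy, ContinuousMap.coe_mk, norm_smul, Real.norm_of_nonneg (hw r).le]
    rw [mul_comm]
    exact mul_le_mul_of_nonneg_right (y.norm_coe_le_norm r) (hw r).le
  have hbound : ∀ (y : BoundedContinuousFunction ℝ (Fin n → ℝ)) (t : ℝ),
      ‖(w t)⁻¹ • (φ' t + J (wy y) t)‖ ≤ ‖φ‖ + 1 / 2 * ‖y‖ := by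
    intro y t
    rw [norm_smul, norm_inv, Real.norm_of_nonneg (hw t).le, inv_mul_le_iff₀ (hw t)]
    refine (norm_add_le _ _).trans ?_
    have h1 := hJ ‖y‖ (wy y) (norm_nonneg _) (hwy y) t
    nlinarith [hφ' t, hw1 t, norm_nonneg φ]
  let P : BoundedContinuousFunction ℝ (Fin n → ℝ) → BoundedContinuousFunction ℝ (Fin n → ℝ) :=
    fun y => BoundedContinuousFunction.ofNormedAddCommGroup
      (fun t => (w t)⁻¹ • (φ' t + J (wy y) t))
      ((w.continuous.inv₀ (fun t => (hw t).ne')).smul (φ'.continuous.add (hJc _)))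
      (‖φ‖ + 1 / 2 * ‖y‖) (hbound y)
  have hP : ContractingWith (1 / 2) P := by
    refine ⟨by norm_num [← NNReal.coe_lt_coe], LipschitzWith.of_dist_le_mul fun y y' => ?_⟩
    refine (BoundedContinuousFunction.dist_le (by positivity)).2 fun t => ?_
    have h1 : P y t - P y' t = (w t)⁻¹ • J (wy (y - y')) t := by
      change (w t)⁻¹ • (φ' t + J (wy y) t) - (w t)⁻¹ • (φ' t + J (wy y') t) = _
      rw [← smul_sub, add_sub_add_left_eq_sub]
      congr 1
      simp only [J]
      rw [← intervalIntegral.integral_sub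
        ((D.continuous_L_history _).intervalIntegrable _ _)
        ((D.continuous_L_history _).intervalIntegrable _ _)]
      refine intervalIntegral.integral_congr fun r _ => ?_
      have h2 : history h (wy (y - y')) r = history h (wy y) r - history h (wy y') r := by
        ext θ i
        simp [history, wy, mul_sub]
      simp only [h2, map_sub]
    rw [dist_eq_norm, h1, norm_smul, norm_inv, Real.norm_of_nonneg (hw t).le,
      inv_mul_le_iff₀ (hw t), dist_eq_norm]
    refine (hJ _ _ (norm_nonneg _) (hwy (y - y')) t).trans_eq ?_
    push_cast
    ring
  let y := ContractingWith.fixedPoint P hP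
  have hy : ∀ t, wy y t = φ' t + J (wy y) t := by
    intro t
    have h1 : P y = y := hP.fixedPoint_isFixedPt
    have h2 : y t = (w t)⁻¹ • (φ' t + J (wy y) t) := by
      conv_lhs => rw [← h1]
      rfl
    change w t • y t = _
    rw [h2, smul_inv_smul₀ (hw t).ne']
  refine ⟨wy y, ?_, fun t ht => ?_⟩
  · ext θ i
    have hJ0 : J (wy y) (s + θ) = 0 := by
      simp only [J]
      rw [max_eq_left (by linarith [θ.2.2]), intervalIntegral.integral_same]
    simp only [history, ContinuousMap.coe_mk]
    rw [hy, hJ0, add_zero]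
    simp [φ']
  · have h1 : HasDerivAt (fun t => φ ⟨0, by linarith, le_rfl⟩ + ∫ r in s..t, D.L r (history h (wy y) r))
        (D.L t (history h (wy y) t)) t :=
      ((D.continuous_L_history (wy y)).integral_hasStrictDerivAt s t).hasDerivAt.const_add _
    have h2 : ∀ r, s ≤ r → wy y r =
        φ ⟨0, by linarith, le_rfl⟩ + ∫ r in s..r, D.L r (history h (wy y) r) := by
      intro r hr
      rw [hy]
      simp only [J, max_eq_right hr, φ', ContinuousMap.coe_mk]
      rw [Set.IccExtend_of_right_le _ _ (by linarith)]
    exact h1.hasDerivWithinAt.congr (fun r hr => h2 r hr) (h2 t ht)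

/-- The evolutionary system is well defined: there is exactly one bounded linear operator that maps
every initial history `φ` at time `s` to the segment `x_t` of the solution starting from `φ`. -/
theorem existsUnique_evolution {s t : ℝ} (hst : s ≤ t) :
    ∃! U : C(Set.Icc (-h) (0 : ℝ), Fin n → ℝ) →L[ℝ] C(Set.Icc (-h) (0 : ℝ), Fin n → ℝ),
      ∀ φ x, D.IsSolution s φ x → U φ = history h x t := by
  choose x hx using D.exists_isSolution s
  have huniq : ∀ φ y, D.IsSolution s φ y → history h (x φ) t = history h y t := by
    intro φ y hy
    ext1 θ
    exact (hx φ).unique hy (by linarith [θ.2.1])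
  obtain ⟨a, ha⟩ := D.exists_growth_bound
  let U₀ : C(Set.Icc (-h) (0 : ℝ), Fin n → ℝ) →ₗ[ℝ] C(Set.Icc (-h) (0 : ℝ), Fin n → ℝ) :=
    { toFun := fun φ => history h (x φ) t
      map_add' := fun φ ψ => huniq _ _ ((hx φ).add (hx ψ))
      map_smul' := fun c φ => huniq _ _ ((hx φ).smul c) }
  have hbound : ∀ φ, ‖U₀ φ‖ ≤ 2 * Real.exp (|a| * (t - s)) * ‖φ‖ := by
    intro φ
    refine (ContinuousMap.norm_le _ (by positivity)).2 fun θ => ?_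
    have hE : 1 ≤ Real.exp (|a| * (t - s)) :=
      Real.one_le_exp (mul_nonneg (abs_nonneg a) (by linarith))
    change ‖x φ (t + θ)‖ ≤ _
    rcases le_total s (t + θ) with h1 | h1
    · refine (ha s φ _ (hx φ) _ h1).trans ?_
      have h2 : a * (t + θ - s) ≤ |a| * (t - s) :=
        mul_le_mul (le_abs_self a) (by linarith [θ.2.2]) (by linarith) (abs_nonneg a)
      have h3 := Real.exp_le_exp.2 h2
      nlinarith [norm_nonneg φ]
    · have h2 := (history h (x φ) s).norm_coe_le_norm
        ⟨t + θ - s, by linarith [θ.2.1], by linarith⟩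
      rw [(hx φ).initial] at h2
      have h3 : ‖x φ (t + θ)‖ ≤ ‖φ‖ := by
        have h4 := congrArg (fun ψ : C(Set.Icc (-h) (0 : ℝ), Fin n → ℝ) =>
          ψ ⟨t + θ - s, by linarith [θ.2.1], by linarith⟩) (hx φ).initial
        simp only [history, ContinuousMap.coe_mk, add_sub_cancel] at h4
        rw [h4]
        exact φ.norm_coe_le_norm _
      nlinarith [norm_nonneg φ]
  refine ⟨U₀.mkContinuous _ hbound, huniq, fun V hV => ?_⟩
  ext1 φ
  exact hV φ _ (hx φ)

open Classical in
/-- The evolutionary system `U(t, s) : X → X`, `U(t, s) φ = x_t` for `t ≥ s`, where `x` is the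
solution with `x_s = φ` (and the irrelevant value `0` for `t < s`). -/
def evolution (t s : ℝ) :
    C(Set.Icc (-h) (0 : ℝ), Fin n → ℝ) →L[ℝ] C(Set.Icc (-h) (0 : ℝ), Fin n → ℝ) :=
  if hst : s ≤ t then (D.existsUnique_evolution hst).choose else 0

lemma evolution_apply {s t : ℝ} (hst : s ≤ t) {φ : C(Set.Icc (-h) (0 : ℝ), Fin n → ℝ)}
    {x : C(ℝ, Fin n → ℝ)} (hx : D.IsSolution s φ x) : D.evolution t s φ = history h x t := by
  rw [evolution, dif_pos hst]
  exact (D.existsUnique_evolution hst).choose_spec.1 φ x hx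

/-- `μ` is a Floquet multiplier: a nonzero eigenvalue of (the complexification of) the monodromy
operator `U(s + T, s)` at time `s`. -/
def IsFloquetMultiplier (s : ℝ) (μ : ℂ) : Prop :=
  μ ≠ 0 ∧ Module.End.HasEigenvalue (complexify (D.evolution (s + T) s)) μ

/-- `σ` is a Floquet exponent if `e^{σ T}` is a Floquet multiplier. -/
def IsFloquetExponent (s : ℝ) (σ : ℂ) : Prop :=
  D.IsFloquetMultiplier s (Complex.exp (σ * T))

end PeriodicLinearDDE

end

noncomputable section

/-! ### Unbounded operators given by a resolvent equation -/

/-! For `c > 0` the operator `d/dτ + c` on `C_T` has an everywhere defined inverse `R` with `‖R‖ ≤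
1/c`, compact by Arzelà–Ascoli (`CT.exists_resolvent`). The delay term is a bounded operator `K` on
`C_T`, so `Δ(z) q = f` is equivalent to `q = R (K q + f - (z - c) q)`, with membership of `q` in the
domain built in (`mem_graph_charOp_iff_resolvent`). The operator-theoretic claims follow from this
equation. It is continuous in `(q, f)`, so the graph is closed. For `c > ‖K‖` a Neumann series puts
`z - c` in the resolvent set. Finally, `1 - R (K - (z - c))` is a compact perturbation of the
identity, so by Riesz–Schauder it can only fail to be invertible by having a kernel, which consists
of the `q` with `Δ(z) q = 0`.

For Floquet exponents, put `y(t) = e^{σt} q(t)`. Then `Δ(σ) q = 0` says that `y` solves the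
complexified delay equation, and periodicity of `q` says `y(t + T) = e^{σT} y(t)`; the segment of
`y` at any time `s` is then an eigenvector of the monodromy operator. Conversely, an eigenvector
only yields a solution forward from `s`, so `e^{-σt} y(t)` is periodic only on `[s - h, ∞)`. It is
extended periodically to the whole line (`exists_periodic_extension`), and the equation holds
everywhere because any time can be moved beyond `s` by whole periods. Independence of `s` comes for
free, since `Δ` does not involve `s`. -/

/-- Bounded linear operators on a normed space. -/
abbrev Endo (E : Type*) [NormedAddCommGroup E] [NormedSpace ℂ E] := E →L[ℂ] E

/-- Turns an a priori estimate, linear in the data, into uniqueness: the factor `z - z` is the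
difference of two equal data. -/
lemma eq_of_norm_sub_le_mul {E : Type*} [NormedAddCommGroup E] {x y z : E} {C : ℝ}
    (H : ‖x - y‖ ≤ C * ‖z - z‖) : x = y := by
  rw [sub_self, norm_zero, mul_zero] at H
  exact sub_eq_zero.1 (norm_le_zero_iff.1 H)

section Operators

variable {E : Type*} [NormedAddCommGroup E] [NormedSpace ℂ E]

lemma Endo.exists_of_bound (R₀ : E → E) (hadd : ∀ x y, R₀ (x + y) = R₀ x + R₀ y)
    (hsmul : ∀ (a : ℂ) x, R₀ (a • x) = a • R₀ x) {C : ℝ} (hC : 0 ≤ C)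
    (hbd : ∀ x, ‖R₀ x‖ ≤ C * ‖x‖) : ∃ R : Endo E, (∀ x, R x = R₀ x) ∧ ‖R‖ ≤ C :=
  ⟨LinearMap.mkContinuous { toFun := R₀, map_add' := hadd, map_smul' := hsmul } C hbd,
    fun _ => rfl, LinearMap.mkContinuous_norm_le _ hC _⟩

lemma Endo.isCompactOperator_of_isCompact_closure {R : Endo E}
    (hR : IsCompact (closure (R '' {x | ‖x‖ ≤ 1}))) : IsCompactOperator R := by
  rw [← show Metric.closedBall (0 : E) 1 = {x | ‖x‖ ≤ 1} from
    Set.ext fun x => mem_closedBall_zero_iff] at hR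
  exact (isCompactOperator_iff_isCompact_closure_image_closedBall (R : E →ₗ[ℂ] E) zero_lt_one).2 hR

variable {A : E →ₗ.[ℂ] E} {R B : Endo E}

/-- The graph is the equalizer of two continuous maps on `E × E`, because `R` and `B` are bounded
and everywhere defined. -/
lemma LinearPMap.isClosed_of_resolvent_eq
    {a : ℂ} (H : ∀ q f, (q, f) ∈ A.graph ↔ q = R (B q + f - a • q)) : A.IsClosed := by
  have h1 : (A.graph : Set (E × E)) = {p | p.1 = R (B p.1 + p.2 - a • p.1)} := by
    ext ⟨q, f⟩
    exact H q f
  rw [LinearPMap.IsClosed, h1]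
  exact isClosed_eq (by fun_prop) (by fun_prop)

/-- The hypothesis reads `(1 - R B) q = R f`, so the inverse of `A` is `(1 - R B)⁻¹ R`. -/
lemma LinearPMap.opInvertible_of_isUnit (H : ∀ q f, (q, f) ∈ A.graph ↔ q = R (B q + f))
    (hU : IsUnit (1 - R * B)) : OpInvertible A := by
  obtain ⟨U, hU⟩ := hU
  have hU' : ∀ q f, (q, f) ∈ A.graph ↔ q = (↑U⁻¹ : Endo E) (R f) := by
    intro q f
    rw [H, _root_.map_add, ← sub_eq_iff_eq_add']
    have h1 : q - R (B q) = (U : Endo E) q := by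
      rw [hU]
      rfl
    have h2 : (↑U⁻¹ : Endo E) ((U : Endo E) q) = q := DFunLike.congr_fun U.inv_mul q
    have h3 : (U : Endo E) ((↑U⁻¹ : Endo E) (R f)) = R f := DFunLike.congr_fun U.mul_inv (R f)
    rw [h1]
    exact ⟨fun h => by rw [← h, h2], fun h => by rw [h, h3]⟩
  refine ⟨(↑U⁻¹ : Endo E) ∘L R, fun x => ((hU' _ _).1 (A.mem_graph x)).symm, fun y => ?_⟩
  obtain ⟨x, hx, hx'⟩ := (A.mem_graph_iff).1 ((hU' ((↑U⁻¹ : Endo E) (R y)) y).2 rfl)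
  have hd : (↑U⁻¹ : Endo E) (R y) ∈ A.domain := by
    rw [show (↑U⁻¹ : Endo E) (R y) = x from hx.symm]
    exact x.2
  refine ⟨hd, ?_⟩
  refine Eq.trans ?_ hx'
  congr 1
  exact Subtype.ext hx.symm

/-- The Fredholm alternative for an operator with a compact resolvent. -/
lemma LinearPMap.not_opInvertible_iff [CompleteSpace E]
    {K : Endo E} {a : ℂ} (H : ∀ q f, (q, f) ∈ A.graph ↔ q = R (K q + f - a • q))
    (hR : IsCompactOperator R) : ¬ OpInvertible A ↔ ∃ q : A.domain, q ≠ 0 ∧ A q = 0 := by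
  -- The zeroth-order term `-a q` is absorbed into the bounded perturbation.
  obtain ⟨B, H⟩ : ∃ B : Endo E, ∀ q f, (q, f) ∈ A.graph ↔ q = R (B q + f) :=
    ⟨K - a • ContinuousLinearMap.id ℂ E, fun q f => by rw [H, add_sub_right_comm]; rfl⟩
  constructor
  · intro h1
    have hc : IsCompactOperator (R * B : Endo E) := hR.comp_clm B
    -- Riesz–Schauder for the compact operator `R B` at the value `1`: a fixed vector of `R B` lies
    -- in the kernel of `A`, and otherwise `1 - R B` is a unit.
    rcases hc.hasEigenvalue_or_mem_resolventSet (one_ne_zero (α := ℂ)) with h2 | h2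
    · obtain ⟨v, hv⟩ := h2.exists_hasEigenvector
      have hv1 : R (B v) = v := by simpa using hv.apply_eq_smul
      obtain ⟨x, hx, hx'⟩ := A.mem_graph_iff.1 ((H v 0).2 (by rw [add_zero, hv1]))
      refine ⟨x, fun h => hv.2 ?_, hx'⟩
      exact hx.symm.trans (congrArg Subtype.val h)
    · refine absurd (opInvertible_of_isUnit H ?_) h1
      rwa [spectrum.mem_resolventSet_iff, map_one] at h2
  · rintro ⟨q, hq, hq0⟩ ⟨S, hS, -⟩
    have h1 := hS q
    rw [hq0, _root_.map_zero] at h1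
    exact hq (Subtype.ext h1.symm)

/-- With the shift by `μ` built into the equation, `μ x - A x = g` becomes `(1 - R B) x = R (-g)`,
which a Neumann series solves with a bound. -/
lemma LinearPMap.mem_opResolventSet_of_norm_lt_one [CompleteSpace E] {μ : ℂ}
    (H : ∀ q f, (q, f) ∈ A.graph ↔ q = R (B q + f - μ • q)) (hRB : ‖R * B‖ < 1) :
    μ ∈ opResolventSet A := by
  have h1 : ∀ (x : A.domain), (x : E) - R (B x) = R (-(μ • (x : E) - A x)) := by
    intro x
    have h2 := (H _ _).1 (A.mem_graph x)
    rw [add_sub_assoc, _root_.map_add] at h2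
    rw [neg_sub, sub_eq_iff_eq_add']
    exact h2
  have hbd : ∀ x : A.domain,
      ‖(x : E)‖ ≤ (1 - ‖R * B‖)⁻¹ * ‖R‖ * ‖μ • (x : E) - A x‖ := by
    intro x
    have h2 : ‖(x : E) - R (B x)‖ ≤ ‖R‖ * ‖μ • (x : E) - A x‖ := by
      rw [h1, ← norm_neg (μ • (x : E) - A x)]
      exact R.le_opNorm _
    have h3 : ‖R (B x)‖ ≤ ‖R * B‖ * ‖(x : E)‖ := (R * B).le_opNorm _
    have h4 := norm_sub_norm_le (x : E) (R (B x))
    rw [mul_assoc, ← div_eq_inv_mul, le_div_iff₀ (sub_pos.2 hRB)]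
    linarith
  have hsurj : Function.Surjective (fun x : A.domain => μ • (x : E) - A x) := by
    intro g
    obtain ⟨U, hU⟩ := isUnit_one_sub_of_norm_lt_one hRB
    set q := (↑U⁻¹ : Endo E) (R (-g)) with hq
    have h3 : (U : Endo E) q = R (-g) := DFunLike.congr_fun U.mul_inv (R (-g))
    have h4 : q - R (B q) = R (-g) := by
      rw [← h3, hU]
      rfl
    -- Solving `μ q - A q = g` means prescribing `A q = μ q - g`; the two terms `μ q` then cancel in
    -- the resolvent equation.
    obtain ⟨x, hx, hx'⟩ := A.mem_graph_iff.1 ((H q (μ • q - g)).2 (by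
      rw [add_sub_assoc, sub_sub_cancel_left, _root_.map_add, ← h4, add_sub_cancel]))
    refine ⟨x, ?_⟩
    beta_reduce
    rw [hx', hx, sub_sub_cancel]
  refine ⟨fun x y hxy => ?_, hsurj.denseRange, fun x _ => hsurj x, _, hbd⟩
  have h2 := hbd (x - y)
  have h3 : μ • ((x - y : A.domain) : E) - A (x - y) =
      (μ • (x : E) - A x) - (μ • (y : E) - A y) := by
    rw [A.map_sub, Submodule.coe_sub, smul_sub]
    abel
  rw [h3, show μ • (x : E) - A x = μ • (y : E) - A y from hxy, Submodule.coe_sub] at h2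
  exact Subtype.ext (eq_of_norm_sub_le_mul h2)

end Operators

/-! ### The periodic inhomogeneous equation `q' + c q = f` -/

/-- Integrate `(e^{cs} q)' = e^{cs} f` over `[τ - T, τ]`. By periodicity the left side is `(e^{cτ} -
e^{c(τ - T)}) q(τ)`, and the same positive factor appears in the bound for the right side and
cancels. -/
lemma norm_le_of_periodic_of_hasDerivAt {E : Type*} [NormedAddCommGroup E] [NormedSpace ℝ E]
    [CompleteSpace E] {T c F : ℝ} (hT : 0 < T) (hc : 0 < c) {q f : ℝ → E} (hf : Continuous f)
    (hq : Function.Periodic q T) (hd : ∀ τ, HasDerivAt q (f τ - c • q τ) τ)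
    (hF : ∀ τ, ‖f τ‖ ≤ F) (τ : ℝ) : ‖q τ‖ ≤ F / c := by
  have he : ∀ s, HasDerivAt (fun s => Real.exp (c * s)) (c * Real.exp (c * s)) s := fun s => by
    simpa [mul_comm] using ((hasDerivAt_id s).const_mul c).exp
  have h1 : ∀ s, HasDerivAt (fun s => Real.exp (c * s) • q s) (Real.exp (c * s) • f s) s := by
    intro s
    refine ((he s).smul (hd s)).congr_deriv ?_
    rw [smul_sub, smul_smul, mul_comm _ c, sub_add_cancel]
  have h2 : ∀ s, HasDerivAt (fun s => F / c * Real.exp (c * s)) (F * Real.exp (c * s)) s := by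
    intro s
    refine ((he s).const_mul (F / c)).congr_deriv ?_
    field_simp
  have hi1 : Continuous fun s => Real.exp (c * s) • f s := by fun_prop
  have hi2 : Continuous fun s => F * Real.exp (c * s) := by fun_prop
  have h3 := intervalIntegral.norm_integral_le_of_norm_le (μ := MeasureTheory.volume)
    (f := fun s => Real.exp (c * s) • f s) (g := fun s => F * Real.exp (c * s))
    (by linarith : τ - T ≤ τ)
    (MeasureTheory.ae_of_all _ fun s _ => by
      rw [norm_smul, Real.norm_of_nonneg (Real.exp_pos _).le, mul_comm]
      exact mul_le_mul_of_nonneg_right (hF s) (Real.exp_pos _).le)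
    (hi2.intervalIntegrable _ _)
  rw [intervalIntegral.integral_eq_sub_of_hasDerivAt (fun s _ => h1 s)
      (hi1.intervalIntegrable _ _),
    intervalIntegral.integral_eq_sub_of_hasDerivAt (fun s _ => h2 s)
      (hi2.intervalIntegrable _ _), hq.sub_eq, ← sub_smul, norm_smul, ← mul_sub] at h3
  have h4 : 0 < Real.exp (c * τ) - Real.exp (c * (τ - T)) :=
    sub_pos.2 (Real.exp_lt_exp.2 (by nlinarith))
  rw [Real.norm_of_nonneg h4.le, mul_comm] at h3
  exact le_of_mul_le_mul_right h3 h4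

/-- Variation of constants over one period: `q(τ) = (1 - e^{-cT})⁻¹ ∫_{τ-T}^τ e^{-c(τ-s)} f(s) ds`.
The prefactor is what makes the two endpoint terms add up to `f(τ)`. -/
lemma exists_periodic_hasDerivAt {E : Type*} [NormedAddCommGroup E] [NormedSpace ℝ E]
    [CompleteSpace E] {T c : ℝ} (hT : 0 < T) (hc : 0 < c) {f : ℝ → E} (hf : Continuous f)
    (hp : Function.Periodic f T) :
    ∃ q : ℝ → E, Function.Periodic q T ∧ ∀ τ, HasDerivAt q (f τ - c • q τ) τ := by
  set k : ℝ := 1 - Real.exp (-(c * T)) with hk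
  have hk0 : 0 < k := sub_pos.2 (Real.exp_lt_one_iff.2 (neg_lt_zero.2 (mul_pos hc hT)))
  let g : ℝ → E := fun s => Real.exp (c * s) • f s
  have hg : Continuous g := by fun_prop
  have hgT : ∀ s, g (s + T) = Real.exp (c * T) • g s := fun s => by
    simp only [g]
    rw [hp s, smul_smul, ← Real.exp_add]
    ring_nf
  have hgT' : ∀ s, g (s - T) = Real.exp (-(c * T)) • g s := fun s => by
    have h1 := hgT (s - T)
    rw [sub_add_cancel] at h1
    rw [h1, smul_smul, ← Real.exp_add]
    simp
  refine ⟨fun τ => (Real.exp (-(c * τ)) * k⁻¹) • ∫ s in (τ - T)..τ, g s, fun τ => ?_, fun τ => ?_⟩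
  · have h1 : ∫ s in (τ + T - T)..(τ + T), g s = Real.exp (c * T) • ∫ s in (τ - T)..τ, g s := by
      rw [← intervalIntegral.integral_smul]
      simp_rw [← hgT]
      rw [intervalIntegral.integral_comp_add_right, sub_add_cancel, add_sub_cancel_right]
    beta_reduce
    rw [h1, smul_smul]
    congr 1
    rw [mul_right_comm, ← Real.exp_add]
    ring_nf
  · have h1 : ∀ u, (∫ s in (u - T)..u, g s) =
        (∫ s in (0 : ℝ)..u, g s) - ∫ s in (0 : ℝ)..(u - T), g s :=
      fun u => (intervalIntegral.integral_interval_sub_left (hg.intervalIntegrable _ _)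
        (hg.intervalIntegrable _ _)).symm
    have h2 : ∀ u, HasDerivAt (fun u => ∫ s in (0 : ℝ)..u, g s) (g u) u := fun u =>
      (hg.integral_hasStrictDerivAt 0 u).hasDerivAt
    have h3 : HasDerivAt (fun u => ∫ s in (u - T)..u, g s) (k • g τ) τ := by
      simp_rw [h1]
      refine ((h2 τ).sub ((h2 (τ - T)).comp_sub_const τ T)).congr_deriv ?_
      rw [hgT', hk, sub_smul, one_smul]
    have h4 : HasDerivAt (fun u => Real.exp (-(c * u)) * k⁻¹)
        (-c * (Real.exp (-(c * τ)) * k⁻¹)) τ := by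
      refine ((((hasDerivAt_id τ).const_mul c).neg.exp).mul_const k⁻¹).congr_deriv ?_
      change Real.exp (-(c * τ)) * -(c * 1) * k⁻¹ = _
      ring
    refine (h4.smul h3).congr_deriv ?_
    simp only [g, smul_smul]
    rw [show Real.exp (-(c * τ)) * k⁻¹ * (k * Real.exp (c * τ)) = 1 by
      rw [show Real.exp (-(c * τ)) * k⁻¹ * (k * Real.exp (c * τ)) =
        (Real.exp (-(c * τ)) * Real.exp (c * τ)) * (k⁻¹ * k) by ring, ← Real.exp_add,
        inv_mul_cancel₀ hk0.ne']
      simp, one_smul, neg_mul, neg_smul]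
    abel

/-! ### The Banach space `C_T(ℝ, ℂⁿ)` -/

namespace CT

variable {T : ℝ} {n : ℕ}

lemma ext {p q : CT T n} (H : ∀ τ, p.1 τ = q.1 τ) : p = q :=
  Subtype.ext (BoundedContinuousFunction.ext H)

lemma norm_le {q : CT T n} {C : ℝ} (hC : 0 ≤ C) : ‖q‖ ≤ C ↔ ∀ τ, ‖q.1 τ‖ ≤ C :=
  BoundedContinuousFunction.norm_le hC

lemma norm_apply_le (q : CT T n) (τ : ℝ) : ‖q.1 τ‖ ≤ ‖q‖ :=
  q.1.norm_coe_le_norm τ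

lemma isClosed : IsClosed (CT T n : Set (BoundedContinuousFunction ℝ (Fin n → ℂ))) := by
  have h1 : (CT T n : Set (BoundedContinuousFunction ℝ (Fin n → ℂ))) =
      ⋂ t : ℝ, {q | q (t + T) = q t} := by
    ext q
    simp only [Set.mem_iInter]
    rfl
  rw [h1]
  exact isClosed_iInter fun t => isClosed_eq
    (BoundedContinuousFunction.lipschitz_eval_const _).continuous
    (BoundedContinuousFunction.lipschitz_eval_const _).continuous

instance : CompleteSpace (CT T n) := isClosed.completeSpace_coe

lemma contDiff_of_hasDerivAt {q : ℝ → Fin n → ℂ} {f : ℝ → Fin n → ℂ} (hf : Continuous f)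
    (hd : ∀ τ, HasDerivAt q (f τ) τ) : ContDiff ℝ 1 q := by
  rw [contDiff_one_iff_deriv, funext fun τ => (hd τ).deriv]
  exact ⟨fun τ => (hd τ).differentiableAt, hf⟩

/-- Restriction of a periodic function to a period. -/
def restrict (q : CT T n) : BoundedContinuousFunction (Set.Icc 0 T) (Fin n → ℂ) :=
  q.1.compContinuous ⟨Subtype.val, continuous_subtype_val⟩

/-- Arzelà–Ascoli needs a compact domain; one period already determines the supremum norm. -/
lemma isometry_restrict (hT : 0 < T) : Isometry (restrict (T := T) (n := n)) := by
  refine Isometry.of_dist_eq fun p q => le_antisymm ?_ ?_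
  · exact (BoundedContinuousFunction.dist_le dist_nonneg).2 fun x =>
      BoundedContinuousFunction.dist_coe_le_dist (f := p.1) (g := q.1) x.1
  · refine (BoundedContinuousFunction.dist_le (f := p.1) (g := q.1) dist_nonneg).2 fun x => ?_
    obtain ⟨y, hy, hy'⟩ := (show Function.Periodic (fun x => (p.1 x, q.1 x)) T from fun x =>
      Prod.ext (p.2 x) (q.2 x)).exists_mem_Ico₀ hT x
    have h1 := BoundedContinuousFunction.dist_coe_le_dist (f := restrict p) (g := restrict q)
      ⟨y, hy.1, hy.2.le⟩
    rw [Prod.mk.injEq] at hy'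
    rw [hy'.1, hy'.2]
    exact h1

/-- The Arzelà-Ascoli theorem for periodic functions. -/
lemma isCompact_closure (hT : 0 < T) {S : Set (CT T n)} {C : ℝ} {K : NNReal}
    (hC : ∀ q ∈ S, ‖q‖ ≤ C) (hK : ∀ q ∈ S, LipschitzWith K q.1) : IsCompact (closure S) := by
  have h1 : IsCompact (closure (restrict '' S)) := by
    refine BoundedContinuousFunction.arzela_ascoli (Metric.closedBall 0 C)
      (isCompact_closedBall _ _) _ ?_ ?_
    · rintro _ x ⟨q, hq, rfl⟩
      rw [mem_closedBall_zero_iff]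
      exact (norm_apply_le q x.1).trans (hC q hq)
    · refine (LipschitzWith.uniformEquicontinuous _ K ?_).equicontinuous
      rintro ⟨_, q, hq, rfl⟩
      exact fun x y => hK q hq x.1 y.1
  -- Total boundedness, unlike compactness, pulls back along the isometry without knowing its range;
  -- completeness of `C_T` then gives a compact closure.
  have h2 : TotallyBounded S :=
    (totallyBounded_preimage (isometry_restrict hT).isUniformInducing
      (h1.totallyBounded.subset subset_closure)).subset (Set.subset_preimage_image _ _)
  exact h2.closure.isCompact_of_isClosed isClosed_closure

/-- The operator `d/dτ + c` with `c > 0` has a bounded compact inverse on `C_T(ℝ, ℂⁿ)`. -/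
lemma exists_resolvent (hT : 0 < T) {c : ℝ} (hc : 0 < c) :
    ∃ R : Endo (CT T n), ‖R‖ ≤ c⁻¹ ∧ IsCompactOperator R ∧
      ∀ f q : CT T n, R f = q ↔ ∀ τ, HasDerivAt q.1 (f.1 τ - c • q.1 τ) τ := by
  have hex : ∀ f : CT T n, ∃ q : CT T n, ∀ τ, HasDerivAt q.1 (f.1 τ - c • q.1 τ) τ := by
    intro f
    obtain ⟨q, hq, hd⟩ := exists_periodic_hasDerivAt hT hc f.1.continuous f.2
    exact ⟨CT.mk hT q (continuous_iff_continuousAt.2 fun τ => (hd τ).continuousAt) hq, hd⟩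
  have hbd : ∀ f q : CT T n, (∀ τ, HasDerivAt q.1 (f.1 τ - c • q.1 τ) τ) → ‖q‖ ≤ c⁻¹ * ‖f‖ := by
    intro f q hd
    refine (norm_le (by positivity)).2 fun τ => ?_
    rw [mul_comm, ← div_eq_mul_inv]
    exact norm_le_of_periodic_of_hasDerivAt hT hc f.1.continuous q.2 hd (norm_apply_le f) τ
  choose R₀ hR₀ using hex
  have huniq : ∀ f q : CT T n, (∀ τ, HasDerivAt q.1 (f.1 τ - c • q.1 τ) τ) → R₀ f = q := by
    intro f q hd
    -- Two solutions for the same `f` differ by a solution with datum `f - f`, so the a priori bound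
    -- forces equality.
    have h1 := hbd (f - f) (R₀ f - q) fun τ => by
      refine ((hR₀ f τ).sub (hd τ)).congr_deriv ?_
      change f.1 τ - c • (R₀ f).1 τ - (f.1 τ - c • q.1 τ) =
        (f.1 τ - f.1 τ) - c • ((R₀ f).1 τ - q.1 τ)
      rw [smul_sub]
      abel
    exact eq_of_norm_sub_le_mul h1
  obtain ⟨R, hR, hRn⟩ := Endo.exists_of_bound (E := CT T n) R₀
    (fun f g => huniq _ _ fun τ => by
      refine ((hR₀ f τ).add (hR₀ g τ)).congr_deriv ?_
      change f.1 τ - c • (R₀ f).1 τ + (g.1 τ - c • (R₀ g).1 τ) =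
        f.1 τ + g.1 τ - c • ((R₀ f).1 τ + (R₀ g).1 τ)
      rw [smul_add]
      abel)
    (fun a f => huniq _ _ fun τ => by
      refine ((hR₀ f τ).const_smul a).congr_deriv ?_
      change a • (f.1 τ - c • (R₀ f).1 τ) = a • f.1 τ - c • (a • (R₀ f).1 τ)
      rw [smul_sub, smul_comm a c])
    (inv_nonneg.2 hc.le) (fun f => hbd f _ (hR₀ f))
  refine ⟨R, hRn, ?_, fun f q => ⟨?_, fun hd => (hR f).trans (huniq f q hd)⟩⟩
  · have hcl : IsCompact (closure (R '' {f : CT T n | ‖f‖ ≤ 1})) := ?_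
    · exact Endo.isCompactOperator_of_isCompact_closure (E := CT T n) hcl
    -- On the unit ball `‖q'‖ ≤ ‖f‖ + c ‖q‖ ≤ 1 + c c⁻¹ = 2`, whatever `c` is.
    refine isCompact_closure hT (C := c⁻¹) (K := 2) ?_ ?_
    · rintro _ ⟨f, hf, rfl⟩
      rw [hR]
      exact (hbd f _ (hR₀ f)).trans
        (mul_le_of_le_one_right (by positivity) hf)
    · rintro _ ⟨f, hf, rfl⟩
      rw [hR]
      have hf1 : ‖f‖ ≤ 1 := hf
      refine lipschitzWith_of_nnnorm_deriv_le (fun τ => (hR₀ f τ).differentiableAt) fun τ => ?_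
      change ‖deriv (R₀ f).1 τ‖ ≤ 2
      rw [(hR₀ f τ).deriv]
      refine (norm_sub_le _ _).trans ?_
      rw [norm_smul, Real.norm_of_nonneg hc.le]
      have h1 := mul_le_mul_of_nonneg_left ((norm_apply_le _ τ).trans (hbd f _ (hR₀ f))) hc.le
      rw [mul_inv_cancel_left₀ hc.ne'] at h1
      linarith [norm_apply_le f τ]
  · rintro rfl τ
    rw [hR]
    exact hR₀ f τ

end CT

end
noncomputable section

namespace PeriodicLinearDDE

variable {n : ℕ} {h T : ℝ} (D : PeriodicLinearDDE n h T)

/-! ### Complexification of the equation -/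

/-- The complexification of `L(t)`. -/
def complexL (t : ℝ) : C(Set.Icc (-h) (0 : ℝ), Fin n → ℂ) →ₗ[ℂ] (Fin n → ℂ) where
  toFun φ := (fun i => (D.L t (rePart φ) i : ℂ)) + Complex.I • fun i => (D.L t (imPart φ) i : ℂ)
  map_add' φ ψ := by
    have h1 : rePart (φ + ψ) = rePart φ + rePart ψ := by ext; simp [rePart]
    have h2 : imPart (φ + ψ) = imPart φ + imPart ψ := by ext; simp [imPart]
    rw [h1, h2, map_add, map_add]
    ext i
    simp [mul_add, add_add_add_comm]
  map_smul' c φ := by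
    have h1 : rePart (c • φ) = c.re • rePart φ - c.im • imPart φ := by
      ext; simp [rePart, imPart]
    have h2 : imPart (c • φ) = c.re • imPart φ + c.im • rePart φ := by
      ext; simp [rePart, imPart]
    rw [h1, h2, map_add, map_sub, map_smul, map_smul, map_smul, map_smul]
    ext i
    apply Complex.ext <;> simp

lemma complexL_apply_re (t : ℝ) (φ : C(Set.Icc (-h) (0 : ℝ), Fin n → ℂ)) (i : Fin n) :
    (D.complexL t φ i).re = D.L t (rePart φ) i := by
  simp [complexL]

lemma complexL_apply_im (t : ℝ) (φ : C(Set.Icc (-h) (0 : ℝ), Fin n → ℂ)) (i : Fin n) :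
    (D.complexL t φ i).im = D.L t (imPart φ) i := by
  simp [complexL]

lemma periodic_complexL : Function.Periodic D.complexL T := fun t => by
  ext φ i
  apply Complex.ext
  · rw [complexL_apply_re, complexL_apply_re, D.periodic_L]
  · rw [complexL_apply_im, complexL_apply_im, D.periodic_L]

lemma norm_rePart_le (φ : C(Set.Icc (-h) (0 : ℝ), Fin n → ℂ)) : ‖rePart φ‖ ≤ ‖φ‖ := by
  refine (ContinuousMap.norm_le _ (norm_nonneg _)).2 fun θ => ?_
  refine (pi_norm_le_iff_of_nonneg (norm_nonneg _)).2 fun i => ?_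
  exact (Complex.abs_re_le_norm _).trans ((norm_le_pi_norm (φ θ) i).trans (φ.norm_coe_le_norm θ))

lemma norm_imPart_le (φ : C(Set.Icc (-h) (0 : ℝ), Fin n → ℂ)) : ‖imPart φ‖ ≤ ‖φ‖ := by
  refine (ContinuousMap.norm_le _ (norm_nonneg _)).2 fun θ => ?_
  refine (pi_norm_le_iff_of_nonneg (norm_nonneg _)).2 fun i => ?_
  exact (Complex.abs_im_le_norm _).trans ((norm_le_pi_norm (φ θ) i).trans (φ.norm_coe_le_norm θ))

lemma norm_complexL_le {M t : ℝ} (hM : ‖D.L t‖ ≤ M) (φ : C(Set.Icc (-h) (0 : ℝ), Fin n → ℂ)) :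
    ‖D.complexL t φ‖ ≤ 2 * M * ‖φ‖ := by
  have hM0 : 0 ≤ M := le_trans (norm_nonneg (D.L t)) hM
  refine (pi_norm_le_iff_of_nonneg (by positivity)).2 fun i => ?_
  refine (Complex.norm_le_abs_re_add_abs_im _).trans ?_
  rw [complexL_apply_re, complexL_apply_im]
  have h1 : |D.L t (rePart φ) i| ≤ M * ‖φ‖ :=
    (norm_le_pi_norm (D.L t (rePart φ)) i).trans (((D.L t).le_opNorm _).trans
      (mul_le_mul hM (norm_rePart_le φ) (norm_nonneg _) hM0))
  have h2 : |D.L t (imPart φ) i| ≤ M * ‖φ‖ :=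
    (norm_le_pi_norm (D.L t (imPart φ)) i).trans (((D.L t).le_opNorm _).trans
      (mul_le_mul hM (norm_imPart_le φ) (norm_nonneg _) hM0))
  linarith

lemma continuous_complexL_history (y : C(ℝ, Fin n → ℂ)) :
    Continuous fun t => D.complexL t (history h y t) := by
  have h1 : ∀ x : C(ℝ, Fin n → ℝ), Continuous fun t => fun i => (D.L t (history h x t) i : ℂ) :=
    fun x => continuous_pi fun i => Complex.continuous_ofReal.comp
      ((continuous_apply i).comp (D.continuous_L_history x))
  exact (h1 ⟨fun r i => (y r i).re, by fun_prop⟩).add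
    ((h1 ⟨fun r i => (y r i).im, by fun_prop⟩).const_smul Complex.I)

/-! ### Exponential weights and the delay operator -/

/-- The function `r ↦ e^{zr} q(r)`. -/
def expMul (z : ℂ) (q : C(ℝ, Fin n → ℂ)) : C(ℝ, Fin n → ℂ) :=
  ⟨fun r => Complex.exp (z * r) • q r, by fun_prop⟩

/-- The segment `θ ↦ e^{zθ} q(τ + θ)`. -/
def expHistory (h : ℝ) (z : ℂ) (q : C(ℝ, Fin n → ℂ)) (τ : ℝ) : C(Set.Icc (-h) (0 : ℝ), Fin n → ℂ) :=
  ⟨fun θ => Complex.exp (z * (θ : ℝ)) • q (τ + θ), by fun_prop⟩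

/-- Links the two pictures: segments of a solution `e^{zr} q(r)` of the delay equation, and the
weighted segments of `q` that enter `Δ(z)`. -/
lemma history_expMul (z : ℂ) (q : C(ℝ, Fin n → ℂ)) (τ : ℝ) :
    history h (expMul z q) τ = Complex.exp (z * τ) • expHistory h z q τ := by
  ext θ i
  simp only [history, expMul, expHistory, ContinuousMap.coe_mk, ContinuousMap.smul_apply, smul_smul,
    ← Complex.exp_add]
  push_cast
  rw [mul_add]

lemma exp_smul_history_expMul (z : ℂ) (q : C(ℝ, Fin n → ℂ)) (τ : ℝ) :
    Complex.exp (-z * τ) • history h (expMul z q) τ = expHistory h z q τ := by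
  rw [history_expMul, smul_smul, ← Complex.exp_add]
  simp

lemma stieltjesIntegral_eq_complexL (z : ℂ) (q : C(ℝ, Fin n → ℂ)) (τ : ℝ) :
    stieltjesIntegral h (D.ζ τ) (fun θ => Complex.exp (-z * θ) • q (τ - θ)) =
      D.complexL τ (expHistory h z q τ) := by
  rw [(D.hasStieltjesIntegral_exp z q.continuous τ).eq_integral D.h_pos,
    ← exp_smul_history_expMul, map_smul]
  rfl

/-- The delay term `q ↦ ∫_0^h d₂ζ(·, θ) e^{-zθ} q(· - θ)` is a bounded operator on
`C_T(ℝ, ℂⁿ)`. -/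
lemma exists_delayOperator (z : ℂ) : ∃ K : Endo (CT T n), ∀ (q : CT T n) (τ : ℝ),
    (K q).1 τ = D.complexL τ (expHistory h z q.1.toContinuousMap τ) := by
  obtain ⟨M, hM, hLM⟩ := D.exists_bound
  have hcont : ∀ q : CT T n,
      Continuous fun τ => D.complexL τ (expHistory h z q.1.toContinuousMap τ) := by
    intro q
    -- The weighted segment is a scalar times an ordinary segment of one fixed function, for which
    -- continuity in `τ` is known.
    simp_rw [← exp_smul_history_expMul, map_smul]
    have h1 : Continuous fun τ : ℝ => Complex.exp (-z * τ) := by fun_prop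
    exact h1.smul (D.continuous_complexL_history _)
  have hper : ∀ q : CT T n,
      Function.Periodic (fun τ => D.complexL τ (expHistory h z q.1.toContinuousMap τ)) T := by
    intro q τ
    beta_reduce
    rw [D.periodic_complexL]
    congr 1
    ext1 θ
    have h1 : q.1 (τ + T + θ) = q.1 (τ + θ) := by
      rw [add_right_comm]
      exact q.2 _
    exact congrArg (fun v => Complex.exp (z * (θ : ℝ)) • v) h1
  have hbd : ∀ q : CT T n, ‖CT.mk D.T_pos _ (hcont q) (hper q)‖ ≤
      2 * M * Real.exp (‖z‖ * h) * ‖q‖ := by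
    intro q
    refine (CT.norm_le (by positivity)).2 fun τ => ?_
    refine (D.norm_complexL_le (hLM τ) _).trans ?_
    rw [mul_assoc (2 * M)]
    refine mul_le_mul_of_nonneg_left ?_ (by positivity)
    refine (ContinuousMap.norm_le _ (by positivity)).2 fun θ => ?_
    change ‖Complex.exp (z * (θ : ℝ)) • q.1 (τ + θ)‖ ≤ _
    rw [norm_smul]
    refine mul_le_mul ?_ (CT.norm_apply_le q _) (norm_nonneg _) (Real.exp_pos _).le
    rw [Complex.norm_exp]
    refine Real.exp_le_exp.2 ((Complex.re_le_norm _).trans ?_)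
    rw [norm_mul, Complex.norm_real]
    refine mul_le_mul_of_nonneg_left ?_ (norm_nonneg _)
    rw [Real.norm_of_nonpos θ.2.2]
    linarith [θ.2.1]
  obtain ⟨K, hK, -⟩ := Endo.exists_of_bound (E := CT T n)
    (fun q => CT.mk D.T_pos _ (hcont q) (hper q))
    (fun p q => CT.ext fun τ => by
      change D.complexL τ _ = D.complexL τ _ + D.complexL τ _
      rw [← map_add]
      congr 1
      ext1 θ
      exact smul_add _ (p.1 (τ + θ)) (q.1 (τ + θ)))
    (fun a q => CT.ext fun τ => by
      change D.complexL τ _ = a • D.complexL τ _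
      rw [← map_smul]
      congr 1
      ext1 θ
      exact smul_comm _ a (q.1 (τ + θ)))
    (by positivity) hbd
  exact ⟨K, fun q τ => by rw [hK]; rfl⟩

/-- No `C¹` condition appears on the right: the prescribed derivative is continuous, so
differentiability alone puts `q` in the domain. -/
lemma mem_graph_charOp_iff {z : ℂ} {K : Endo (CT T n)}
    (hK : ∀ (q : CT T n) (τ : ℝ), (K q).1 τ = D.complexL τ (expHistory h z q.1.toContinuousMap τ))
    (q f : CT T n) : (q, f) ∈ (D.charOp z).graph ↔
      ∀ τ, HasDerivAt q.1 (f.1 τ - z • q.1 τ + (K q).1 τ) τ := by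
  have h1 : ∀ τ, D.charFun z q.1 τ = deriv q.1 τ + z • q.1 τ - (K q).1 τ := fun τ => by
    rw [hK, ← D.stieltjesIntegral_eq_complexL]
    rfl
  rw [LinearPMap.mem_graph_iff]
  constructor
  · rintro ⟨x, rfl, rfl⟩ τ
    have h2 : (D.charOp z x).1 τ = D.charFun z x.1.1 τ := rfl
    refine ((CT1.contDiff x).differentiable one_ne_zero τ).hasDerivAt.congr_deriv ?_
    change _ = (D.charOp z x).1 τ - z • x.1.1 τ + (K x.1).1 τ
    rw [h2, h1]
    abel
  · intro hd
    have hq : q ∈ CT1 T n := CT.contDiff_of_hasDerivAt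
      ((f.1.continuous.sub (q.1.continuous.const_smul z)).add (K q).1.continuous) hd
    refine ⟨⟨q, hq⟩, rfl, CT.ext fun τ => ?_⟩
    have h2 : (D.charOp z ⟨q, hq⟩).1 τ = D.charFun z q.1 τ := rfl
    rw [h2, h1, (hd τ).deriv]
    abel

/-- The equation `Δ(z) q = f` in terms of the inverse of `d/dτ + c`. -/
lemma mem_graph_charOp_iff_resolvent {z : ℂ} {K R : Endo (CT T n)} {c : ℝ}
    (hK : ∀ (q : CT T n) (τ : ℝ), (K q).1 τ = D.complexL τ (expHistory h z q.1.toContinuousMap τ))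
    (hR : ∀ f q : CT T n, R f = q ↔ ∀ τ, HasDerivAt q.1 (f.1 τ - c • q.1 τ) τ) (q f : CT T n) :
    (q, f) ∈ (D.charOp z).graph ↔ q = R (K q + f - (z - c) • q) := by
  rw [D.mem_graph_charOp_iff hK, eq_comm, hR]
  refine forall_congr' fun τ => iff_of_eq (congrArg (fun v => HasDerivAt q.1 v τ) ?_)
  change _ = (K q).1 τ + f.1 τ - (z - c) • q.1 τ - c • q.1 τ
  rw [sub_smul, Complex.coe_smul]
  abel

end PeriodicLinearDDE

/-! ### Closedness, invertibility and resolvent set of the characteristic operator -/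

lemma PeriodicLinearDDE.isClosed_charOp {n : ℕ} {h T : ℝ} (D : PeriodicLinearDDE n h T) (z : ℂ) :
    (D.charOp z).IsClosed := by
  obtain ⟨K, hK⟩ := D.exists_delayOperator z
  obtain ⟨R, -, -, hR⟩ := CT.exists_resolvent (n := n) D.T_pos one_pos
  exact LinearPMap.isClosed_of_resolvent_eq (E := CT T n)
    (D.mem_graph_charOp_iff_resolvent hK hR)

lemma PeriodicLinearDDE.not_opInvertible_charOp_iff {n : ℕ} {h T : ℝ}
    (D : PeriodicLinearDDE n h T) (σ : ℂ) :
    ¬ OpInvertible (E := CT T n) (D.charOp σ) ↔ D.IsCharacteristicValue σ := by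
  obtain ⟨K, hK⟩ := D.exists_delayOperator σ
  obtain ⟨R, -, hRc, hR⟩ := CT.exists_resolvent (n := n) D.T_pos one_pos
  exact LinearPMap.not_opInvertible_iff (E := CT T n)
    (D.mem_graph_charOp_iff_resolvent hK hR) hRc

lemma PeriodicLinearDDE.nonempty_opResolventSet_charOp {n : ℕ} {h T : ℝ}
    (D : PeriodicLinearDDE n h T) (z : ℂ) :
    (opResolventSet (E := CT T n) (D.charOp z)).Nonempty := by
  obtain ⟨K, hK⟩ := D.exists_delayOperator z
  -- This choice of `c` gives `‖R K‖ ≤ ‖K‖ / (‖K‖ + 1) < 1`, and the resolvent equation then has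
  -- shift `μ = z - c`.
  have hc : 0 < ‖K‖ + 1 := by positivity
  obtain ⟨R, hRn, -, hR⟩ := CT.exists_resolvent (n := n) D.T_pos hc
  refine ⟨z - (‖K‖ + 1 : ℝ), LinearPMap.mem_opResolventSet_of_norm_lt_one (E := CT T n) (R := R)
    (B := K) (D.mem_graph_charOp_iff_resolvent hK hR) ?_⟩
  refine (norm_mul_le R K).trans_lt ((mul_le_mul_of_nonneg_right hRn (norm_nonneg K)).trans_lt ?_)
  rw [inv_mul_lt_iff₀ hc]
  linarith

end
noncomputable section

namespace PeriodicLinearDDE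

variable {n : ℕ} {h T : ℝ} (D : PeriodicLinearDDE n h T)

/-! ### Complex solutions -/

/-- `y` is a complex solution of `y'(t) = L(t) y_t` for `t ≥ s`. -/
def IsComplexSolution (s : ℝ) (y : C(ℝ, Fin n → ℂ)) : Prop :=
  ∀ t, s ≤ t → HasDerivWithinAt y (D.complexL t (history h y t)) (Set.Ici s) t

/-- The complex function with real part `x` and imaginary part `x'`. -/
def ofReIm (x x' : C(ℝ, Fin n → ℝ)) : C(ℝ, Fin n → ℂ) :=
  ⟨fun t i => ⟨x t i, x' t i⟩, by
    refine continuous_pi fun i => ?_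
    simp_rw [Complex.mk_eq_add_mul_I]
    fun_prop⟩

lemma exists_eq_ofReIm (y : C(ℝ, Fin n → ℂ)) : ∃ x x' : C(ℝ, Fin n → ℝ), y = ofReIm x x' :=
  ⟨⟨fun t i => (y t i).re, by fun_prop⟩, ⟨fun t i => (y t i).im, by fun_prop⟩, rfl⟩

lemma rePart_history_ofReIm (x x' : C(ℝ, Fin n → ℝ)) (t : ℝ) :
    rePart (history h (ofReIm x x') t) = history h x t := rfl

lemma imPart_history_ofReIm (x x' : C(ℝ, Fin n → ℝ)) (t : ℝ) :
    imPart (history h (ofReIm x x') t) = history h x' t := rfl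

lemma ofRealPart_add_I_smul_history (x x' : C(ℝ, Fin n → ℝ)) (t : ℝ) :
    ofRealPart (history h x t) + Complex.I • ofRealPart (history h x' t) =
      history h (ofReIm x x') t := by
  ext θ i
  apply Complex.ext <;> simp [ofRealPart, history, ofReIm]

variable {D}

/-- Since `L(t)` is real, the complex equation decouples; existence, uniqueness and the evolution
system transfer from the real theory through this equivalence. -/
lemma isComplexSolution_ofReIm_iff {s : ℝ} {x x' : C(ℝ, Fin n → ℝ)} :
    D.IsComplexSolution s (ofReIm x x') ↔
      D.IsSolution s (history h x s) x ∧ D.IsSolution s (history h x' s) x' := by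
  constructor
  · intro H
    refine ⟨⟨rfl, fun t ht => hasDerivWithinAt_pi.2 fun i => ?_⟩,
      ⟨rfl, fun t ht => hasDerivWithinAt_pi.2 fun i => ?_⟩⟩
    · have h1 := Complex.reCLM.hasFDerivAt.comp_hasDerivWithinAt t (hasDerivWithinAt_pi.1 (H t ht) i)
      refine h1.congr_deriv ?_
      rw [Complex.reCLM_apply, complexL_apply_re, rePart_history_ofReIm]
    · have h1 := Complex.imCLM.hasFDerivAt.comp_hasDerivWithinAt t (hasDerivWithinAt_pi.1 (H t ht) i)
      refine h1.congr_deriv ?_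
      rw [Complex.imCLM_apply, complexL_apply_im, imPart_history_ofReIm]
  · rintro ⟨H, H'⟩ t ht
    refine hasDerivWithinAt_pi.2 fun i => ?_
    have h1 := (hasDerivWithinAt_pi.1 (H.deriv t ht) i).ofReal_comp.add
      ((hasDerivWithinAt_pi.1 (H'.deriv t ht) i).ofReal_comp.mul_const Complex.I)
    have h2 : ∀ r, ofReIm x x' r i = (x r i : ℂ) + (x' r i : ℂ) * Complex.I := fun r =>
      Complex.mk_eq_add_mul_I _ _
    refine (h1.congr (fun r _ => h2 r) (h2 t)).congr_deriv ?_
    apply Complex.ext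
    · simp [complexL_apply_re, rePart_history_ofReIm]
    · simp [complexL_apply_im, imPart_history_ofReIm]

lemma exists_isComplexSolution (D : PeriodicLinearDDE n h T) (s : ℝ)
    (φ : C(Set.Icc (-h) (0 : ℝ), Fin n → ℂ)) :
    ∃ y, D.IsComplexSolution s y ∧ history h y s = φ := by
  obtain ⟨x, hx⟩ := D.exists_isSolution s (rePart φ)
  obtain ⟨x', hx'⟩ := D.exists_isSolution s (imPart φ)
  refine ⟨ofReIm x x', isComplexSolution_ofReIm_iff.2 ⟨?_, ?_⟩, ?_⟩
  · rwa [hx.initial]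
  · rwa [hx'.initial]
  · rw [← ofRealPart_add_I_smul_history, hx.initial, hx'.initial]
    ext θ i
    apply Complex.ext <;> simp [ofRealPart, rePart, imPart]

lemma IsComplexSolution.complexify_evolution {s t : ℝ} {y : C(ℝ, Fin n → ℂ)}
    (hy : D.IsComplexSolution s y) (hst : s ≤ t) :
    complexify (D.evolution t s) (history h y s) = history h y t := by
  obtain ⟨x, x', rfl⟩ := exists_eq_ofReIm y
  obtain ⟨hx, hx'⟩ := isComplexSolution_ofReIm_iff.1 hy
  rw [← ofRealPart_add_I_smul_history x x' t, ← D.evolution_apply hst hx,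
    ← D.evolution_apply hst hx']
  rfl

lemma IsComplexSolution.unique {s t : ℝ} {y w : C(ℝ, Fin n → ℂ)} (hy : D.IsComplexSolution s y)
    (hw : D.IsComplexSolution s w) (h0 : history h y s = history h w s) (ht : s - h ≤ t) :
    y t = w t := by
  obtain ⟨x, x', rfl⟩ := exists_eq_ofReIm y
  obtain ⟨v, v', rfl⟩ := exists_eq_ofReIm w
  obtain ⟨hx, hx'⟩ := isComplexSolution_ofReIm_iff.1 hy
  obtain ⟨hv, hv'⟩ := isComplexSolution_ofReIm_iff.1 hw
  have h1 : history h x s = history h v s := congrArg rePart h0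
  have h2 : history h x' s = history h v' s := congrArg imPart h0
  rw [h1] at hx
  rw [h2] at hx'
  funext i
  exact Complex.ext (congrFun (hx.unique hv ht) i) (congrFun (hx'.unique hv' ht) i)

lemma IsComplexSolution.smul {s : ℝ} {y : C(ℝ, Fin n → ℂ)} (hy : D.IsComplexSolution s y) (c : ℂ) :
    D.IsComplexSolution s (c • y) := by
  intro t ht
  have h1 : history h (c • y) t = c • history h y t := rfl
  rw [h1, map_smul]
  exact (hy t ht).const_smul c

/-- By periodicity of `L`, translating by `T` preserves the equation. The shifted function starts
from the segment at time `s + T`, which is how the monodromy operator is compared with translation.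
-/
lemma IsComplexSolution.shift {s : ℝ} {y : C(ℝ, Fin n → ℂ)} (hy : D.IsComplexSolution s y) :
    D.IsComplexSolution s ⟨fun t => y (t + T), by fun_prop⟩ := by
  intro t ht
  have hT := D.T_pos
  have h1 := (hy (t + T) (by linarith)).scomp t
    ((hasDerivAt_id t).add_const T).hasDerivWithinAt (s := Set.Ici s)
    (fun r (hr : s ≤ r) => show s ≤ r + T by linarith)
  refine h1.congr_deriv ?_
  rw [one_smul, D.periodic_complexL]
  congr 1
  ext1 θ
  exact congrArg y (add_right_comm t T θ)

lemma hasDerivAt_expMul (z : ℂ) {q : C(ℝ, Fin n → ℂ)} {q' : Fin n → ℂ} {t : ℝ}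
    (hq : HasDerivAt q q' t) :
    HasDerivAt (expMul z q) (Complex.exp (z * t) • (z • q t + q')) t := by
  have h1 : HasDerivAt (fun r : ℝ => Complex.exp (z * r)) (Complex.exp (z * t) * z) t := by
    simpa using (((hasDerivAt_id t).ofReal_comp.const_mul z).cexp)
  refine (h1.smul hq).congr_deriv ?_
  rw [smul_add, smul_smul, add_comm]

/-! ### Characteristic values and Floquet exponents -/

lemma isCharacteristicValue_iff {σ : ℂ} : D.IsCharacteristicValue σ ↔ ∃ q : CT T n, q ≠ 0 ∧
    ∀ τ, HasDerivAt q.1 (D.complexL τ (expHistory h σ q.1.toContinuousMap τ) - σ • q.1 τ) τ := by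
  obtain ⟨K, hK⟩ := D.exists_delayOperator σ
  have h1 : ∀ q : CT T n, (q, 0) ∈ (D.charOp σ).graph ↔
      ∀ τ, HasDerivAt q.1 (D.complexL τ (expHistory h σ q.1.toContinuousMap τ) - σ • q.1 τ) τ := by
    intro q
    rw [D.mem_graph_charOp_iff hK]
    refine forall_congr' fun τ => iff_of_eq (congrArg (fun v => HasDerivAt q.1 v τ) ?_)
    rw [hK]
    change 0 - _ + _ = _
    abel
  simp_rw [← h1, LinearPMap.mem_graph_iff]
  constructor
  · rintro ⟨q, hq, hq0⟩
    exact ⟨q.1, fun H => hq (Subtype.ext H), q, rfl, hq0⟩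
  · rintro ⟨_, hq, q, rfl, hq0⟩
    exact ⟨q, fun H => hq (congrArg Subtype.val H), hq0⟩

lemma exists_le_add_nat_mul (hT : 0 < T) (a t : ℝ) : ∃ k : ℕ, a < t + k * T := by
  obtain ⟨k, hk⟩ := exists_nat_gt ((a - t) / T)
  rw [div_lt_iff₀ hT] at hk
  exact ⟨k, by linarith⟩

/-- The eigenvector is the segment at `s` of `e^{σt} q(t)`, an entire solution that each period
multiplies by `e^{σT}`. -/
lemma IsCharacteristicValue.isFloquetExponent {σ : ℂ} (hσ : D.IsCharacteristicValue σ) (s : ℝ) :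
    D.IsFloquetExponent s σ := by
  obtain ⟨q, hq, hd⟩ := isCharacteristicValue_iff.1 hσ
  set y := expMul σ q.1.toContinuousMap with hy
  have hsol : D.IsComplexSolution s y := by
    intro t ht
    refine ((hasDerivAt_expMul σ (hd t)).congr_deriv ?_).hasDerivWithinAt
    rw [hy, history_expMul, map_smul]
    congr 1
    exact add_sub_cancel _ _
  have hT := D.T_pos
  refine ⟨Complex.exp_ne_zero _, Module.End.hasEigenvalue_of_hasEigenvector
    (x := history h y s) ⟨Module.End.mem_eigenspace_iff.2 ?_, fun h0 => hq (CT.ext fun t => ?_)⟩⟩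
  · rw [hsol.complexify_evolution (by linarith)]
    ext1 θ
    change Complex.exp (σ * (s + T + θ : ℝ)) • q.1 (s + T + θ) =
      Complex.exp (σ * T) • Complex.exp (σ * (s + θ : ℝ)) • q.1 (s + θ)
    rw [add_right_comm, q.2, smul_smul, ← Complex.exp_add]
    congr 2
    push_cast
    ring
  -- Were the segment zero, forward uniqueness against the zero solution `0 • y` would kill `y` on
  -- `[s - h, ∞)`; since `q` is periodic, it would vanish at every `t`.
  · obtain ⟨k, hk⟩ := exists_le_add_nat_mul hT (s - h) t
    have h1 := (hsol.unique (hsol.smul 0) (h0.trans (ContinuousMap.ext fun θ =>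
      (zero_smul ℂ (y (s + θ))).symm)) hk.le).trans (zero_smul ℂ (y (t + k * T)))
    have h2 : q.1 (t + k * T) = q.1 t := (show Function.Periodic q.1 T from q.2).nat_mul k t
    rw [← h2]
    exact (smul_eq_zero.1 (show Complex.exp (σ * (t + k * T : ℝ)) • q.1 (t + k * T) = 0 from
      h1)).resolve_left (Complex.exp_ne_zero _)

/-- A continuous function that is periodic on a half-line agrees there with a continuous periodic
function on the whole line. -/
lemma exists_periodic_extension {E : Type*} [TopologicalSpace E] (hT : 0 < T) {a : ℝ} (p : C(ℝ, E))
    (hp : ∀ t, a ≤ t → p (t + T) = p t) : ∃ q : C(ℝ, E), Function.Periodic q T ∧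
      ∀ (t : ℝ) (k : ℕ), a ≤ t + k * T → q t = p (t + k * T) := by
  have h1 : ∀ (t : ℝ) (k : ℕ), a ≤ t → p (t + k * T) = p t := by
    intro t k ht
    induction k with
    | zero => simp
    | succ k ih =>
      rw [← ih, ← hp (t + k * T) (by nlinarith [(Nat.cast_nonneg k : (0 : ℝ) ≤ k)])]
      congr 1
      push_cast
      ring
  have h2 : ∀ (t : ℝ) (k l : ℕ), a ≤ t + k * T → k ≤ l → p (t + l * T) = p (t + k * T) := by
    intro t k l hk hkl
    obtain ⟨m, rfl⟩ := Nat.exists_eq_add_of_le hkl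
    rw [← h1 (t + k * T) m hk]
    congr 1
    push_cast
    ring
  -- The number of periods depends on `t`, but by `h3` the value does not depend on which admissible
  -- number is used.
  choose k hk using exists_le_add_nat_mul hT a
  have h3 : ∀ (t : ℝ) (l : ℕ), a ≤ t + l * T → p (t + k t * T) = p (t + l * T) := by
    intro t l hl
    rcases le_total (k t) l with hkl | hkl
    · exact (h2 t _ _ (hk t).le hkl).symm
    · exact h2 t _ _ hl hkl
  refine ⟨⟨fun t => p (t + k t * T), continuous_iff_continuousAt.2 fun t => ?_⟩, fun t => ?_, h3⟩
  -- The inequality `a < t + k t * T` is strict, hence persists near `t`, so the number of periods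
  -- can be frozen locally.
  · have h4 : (fun r => p (r + k r * T)) =ᶠ[nhds t] fun r => p (r + k t * T) := by
      have h5 : Continuous fun r : ℝ => r + k t * T := by fun_prop
      filter_upwards [h5.continuousAt.eventually (lt_mem_nhds (hk t))] with r hr
      exact h3 r _ (le_of_lt hr)
    refine ContinuousAt.congr ?_ h4.symm
    fun_prop
  · have h4 : t + T + k t * T = t + (k t + 1 : ℕ) * T := by
      push_cast
      ring
    change p (t + T + k (t + T) * T) = p (t + k t * T)
    rw [h3 (t + T) (k t) (by linarith [hk t]), h4, h2 t (k t) (k t + 1) (hk t).le (by omega)]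

/-- The solution through an eigenvector, multiplied by `e^{-σt}`, is periodic from `s - h` on; its
periodic extension is the required kernel element. -/
lemma IsFloquetExponent.isCharacteristicValue {σ : ℂ} {s : ℝ} (hσ : D.IsFloquetExponent s σ) :
    D.IsCharacteristicValue σ := by
  obtain ⟨φ, hφ⟩ := hσ.2.exists_hasEigenvector
  obtain ⟨y, hy, rfl⟩ := D.exists_isComplexSolution s φ
  have hT := D.T_pos
  -- Both sides are solutions from `s`, and the eigenvalue equation says that their segments at `s`
  -- agree.
  have hyT : ∀ t, s - h ≤ t → y (t + T) = Complex.exp (σ * T) • y t := fun t ht => by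
    refine hy.shift.unique (hy.smul _) ?_ ht
    have h1 := hφ.apply_eq_smul
    rw [hy.complexify_evolution (by linarith)] at h1
    refine Eq.trans ?_ h1
    ext1 θ
    exact congrArg y (add_right_comm s (θ : ℝ) T)
  set p := expMul (-σ) y with hp
  have hpy : expMul σ p = y := by
    ext1 t
    change Complex.exp (σ * t) • Complex.exp (-σ * t) • y t = y t
    rw [smul_smul, ← Complex.exp_add]
    simp
  obtain ⟨q, hq, hqp⟩ := exists_periodic_extension hT (a := s - h) p fun t ht => by
    change Complex.exp (-σ * (t + T : ℝ)) • y (t + T) = Complex.exp (-σ * t) • y t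
    rw [hyT t ht, smul_smul, ← Complex.exp_add]
    congr 2
    push_cast
    ring
  refine isCharacteristicValue_iff.2 ⟨CT.mk hT q q.continuous hq, fun h0 => hφ.2 ?_, fun τ => ?_⟩
  -- On `[s - h, s]` no shift is needed (`k = 0`), so `q = 0` would make the eigenvector vanish.
  · have h1 : ∀ t, q t = 0 := fun t => congrArg (fun f : CT T n => f.1 t) h0
    ext1 θ
    have h2 : p (s + θ) = 0 := by
      rw [← h1 (s + θ), hqp (s + θ) 0 (by simp; linarith [θ.2.1])]
      simp
    exact (smul_eq_zero.1 h2).resolve_left (Complex.exp_ne_zero _)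
  -- Moving strictly past `s` turns the one-sided derivative of the solution into a two-sided one,
  -- and keeps the whole delay interval in the range where `q` agrees with `p`.
  · obtain ⟨k, hk⟩ := exists_le_add_nat_mul hT s τ
    have hh := D.h_pos
    have h1 : expHistory h σ q τ = expHistory h σ p (τ + k * T) := by
      ext1 θ
      change Complex.exp _ • q (τ + θ) = Complex.exp _ • p (τ + k * T + θ)
      rw [hqp (τ + θ) k (by linarith [θ.2.1]), add_right_comm]
    have h2 : HasDerivAt p (D.complexL (τ + k * T) (expHistory h σ p (τ + k * T)) -
        σ • p (τ + k * T)) (τ + k * T) := by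
      refine (hasDerivAt_expMul (-σ)
        ((hy _ hk.le).hasDerivAt (Ici_mem_nhds hk))).congr_deriv ?_
      rw [← exp_smul_history_expMul, hpy, map_smul, smul_add, neg_smul, smul_neg, smul_comm _ σ,
        neg_add_eq_sub]
      rfl
    have h3 : q =ᶠ[nhds τ] fun r => p (r + k * T) := by
      have h5 : Continuous fun r : ℝ => r + k * T := by fun_prop
      filter_upwards [h5.continuousAt.eventually (lt_mem_nhds hk)] with r hr
      exact hqp r k (by linarith)
    refine ((h2.comp_add_const τ _).congr_of_eventuallyEq h3).congr_deriv ?_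
    rw [← h1, ← hqp τ k (by linarith), (D.periodic_complexL.nat_mul k) τ]
    rfl

end PeriodicLinearDDE

theorem lemma3p1 {n : ℕ} {h T : ℝ} (D : PeriodicLinearDDE n h T) :
    (∀ z : ℂ, (D.charOp z).IsClosed ∧ (opResolventSet (E := CT T n) (D.charOp z)).Nonempty) ∧
    {σ : ℂ | ¬ OpInvertible (E := CT T n) (D.charOp σ)} = {σ : ℂ | D.IsCharacteristicValue σ} ∧
    ∀ s : ℝ, {σ : ℂ | D.IsCharacteristicValue σ} = {σ : ℂ | D.IsFloquetExponent s σ} :=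
  ⟨fun z => ⟨D.isClosed_charOp z, D.nonempty_opResolventSet_charOp z⟩,
    Set.ext D.not_opInvertible_charOp_iff, fun s => Set.ext fun _ =>
      ⟨fun hσ => hσ.isFloquetExponent s,
        PeriodicLinearDDE.IsFloquetExponent.isCharacteristicValue⟩⟩

end
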